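/- **Conventions.** Let $K$ be a field with $\operatorname{char}K\neq 2$ and $V=\bigoplus_{k\in\mathbb Z}V^k$ a $\mathbb Z$-graded $K$-vector space. Degrees of homogeneous elements are written as the elements themselves in exponents of $-1$. Let $V\otimes V$ carry the total grading, and let $s$ be the suspension, $|sX|=|X|+1$. *Graded Balavoine algebra.* For a graded vector space $A$ let $\mathrm{CL}^n(A)$ be the space of degree $n$ linear maps $f=\sum_{i\ge1}f_i:\bigoplus_{i\ge 1}A^{\otimes i}\to A$. For $f\in \mathrm{CL}^m(A)$, $g\in\mathrm{CL}^n(A)$ put $[f,g]_B=f\,\bar\circ\, g-(-1)^{mn}g\,\bar\circ\, f$, where the component of $f\,\bar\circ\, g$ on $A^{\otimes r}$ is $\sum_{i+j=r+1}\sum_{k=1}^{i}f_i\,\bar\circ_k\, g_j$ and, on homogeneous elements, $$(f_i\bar\circ_k g_j)(v_1,\dots,v_r)=\sum_{\sigma\in \mathbb S_{(k-1,j-1)}}(-1)^{n(v_{\sigma(1)}+\cdots+v_{\sigma(k-1)})}\varepsilon(\sigma)\,f_i\big(v_{\sigma(1)},\dots,v_{\sigma(k-1)},g_j(v_{\sigma(k)},\dots,v_{\sigma(k+j-2)},v_{k+j-1}),v_{k+j},\dots,v_r\big);$$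 here $\sigma$ runs over the $(k-1,j-1)$-shuffles and $\varepsilon(\sigma)$ is the Koszul sign of the permutation of the $v$'s. A Leibniz$_\infty$-algebra structure on $A$ is an element $\ell=\sum_{i\ge1}\ell_i\in\mathrm{CL}^1(A)$ with $[\ell,\ell]_B=0$. *Nambu side.* Let $\mathrm{CV}^n(V)$ be the space of families $f=(f_{2p-1})_{p\ge1}$ of linear maps $f_{2p-1}:(V\otimes V)^{\otimes(p-1)}\otimes V\to V$ of degree $n+p-1$. Define linear maps $\Psi:\mathrm{CV}^n(V)\to \mathrm{CL}^n(s(V\otimes V))$ by $$(\Psi f)_p(sX_1,\dots,sX_{p-1},s(x\otimes y))=(-1)^{\frac{p(p-1)}2}s\Big(f_{2p-1}(X_1,\dots,X_{p-1},x)\otimes y+(-1)^{x(X_1+\cdots+X_{p-1}+n+p-1)}x\otimes f_{2p-1}(X_1,\dots,X_{p-1},y)\Big)$$ for homogeneous $X_i\in V\otimes V$ and $x,y\in V$, and a bracket on $\mathrm{CV}^\bullet(V)$ by $[\![f,g]\!]=\Psi^{-1}\big([\Psi f,\Psi g]_B\big)$. A homotopy Nambu algebra structure on $V$ is a $\pi=(\pi_{2k-1})_{k\ge1}\in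 \mathrm{CV}^1(V)$ (so $\pi_{2k-1}$ has degree $k$) with $[\![\pi,\pi]\!]=0$. **Statement.** The maps $\Psi$ are injective, the bracket $[\![\cdot,\cdot]\!]$ is well defined (that is, $[\Psi f,\Psi g]_B$ always lies in the image of $\Psi$), $(\mathrm{CV}^\bullet(V),[\![\cdot,\cdot]\!])$ and $(\mathrm{CL}^\bullet(s(V\otimes V)),[\cdot,\cdot]_B)$ are graded Lie algebras, and $\Psi$ is a homomorphism of graded Lie algebras between them. Consequently, for every homotopy Nambu algebra $(V,\{\pi_{2k-1}\}_{k\ge1})$, the element $\ell=\Psi(\pi)$ is a Leibniz$_\infty$-algebra structure on $s(V\otimes V)$. Explicitly, $\ell_i(sX_1,\dots,sX_i)=(-1)^{\frac{i(i-1)}2}\,s\,\varpi_i(X_1,\dots,X_i)$, where for homogeneous $X_1,\dots,X_{i-1}\in V\otimes V$ and homogeneous $x_i,y_i\in V$, with $X_i=x_i\otimes y_i$, $$\varpi_i(X_1,\dots,X_i)=\pi_{2i-1}(X_1,\dots,X_{i-1},x_i)\otimes y_i+(-1)^{x_i(X_1+\cdots+X_{i-1}+i)}\,x_i\otimes\pi_{2i-1}(X_1,\dots,X_{i-1},y_i).$$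 -/

import Mathlib

open scoped TensorProduct

noncomputable section

namespace HomotopyNambu

/-! ### Signs, graded vector spaces, tensor square and suspension -/

/-- The sign `(-1)^x`, for `x` an integer modulo `2`. -/
def psgn (x : ZMod 2) : ℤ := (-1) ^ x.val

variable {K A V : Type*} [Field K]
  [AddCommGroup A] [Module K A] [AddCommGroup V] [Module K V]

/-- For a `ℤ`-graded vector space `A = ⨁ 𝒜 i`, the projection of `A` onto the sum of the
components whose degree has parity `a`. -/
def parityProj (𝒜 : ℤ → Submodule K A) [DirectSum.Decomposition 𝒜] (a : ZMod 2) : A →ₗ[K] A :=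
  (DirectSum.toModule K ℤ A fun i : ℤ => if (i : ZMod 2) = a then (𝒜 i).subtype else 0) ∘ₗ
    (DirectSum.decomposeLinearEquiv 𝒜).toLinearMap

theorem parityProj_apply (𝒜 : ℤ → Submodule K A) [DirectSum.Decomposition 𝒜] (a : ZMod 2)
    {i : ℤ} {x : A} (hx : x ∈ 𝒜 i) :
    parityProj 𝒜 a x = if (i : ZMod 2) = a then x else 0 := by
  lift x to 𝒜 i using hx
  simp only [parityProj, LinearMap.comp_apply, LinearEquiv.coe_coe,
    DirectSum.decomposeLinearEquiv_apply_coe, DirectSum.toModule_lof]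
  split_ifs <;> simp

theorem parityProj_mem (𝒜 : ℤ → Submodule K A) [DirectSum.Decomposition 𝒜] (a : ZMod 2)
    {i : ℤ} {x : A} (hx : x ∈ 𝒜 i) : parityProj 𝒜 a x ∈ 𝒜 i := by
  rw [parityProj_apply 𝒜 a hx]
  split_ifs
  · exact hx
  · exact zero_mem _

/-- The linear map `x ↦ (-1)^(δ |x|) x`. -/
def parityTwist (𝒜 : ℤ → Submodule K A) [DirectSum.Decomposition 𝒜] (δ : ZMod 2) : A →ₗ[K] A :=
  parityProj 𝒜 0 + psgn δ • parityProj 𝒜 1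

theorem parityTwist_apply (𝒜 : ℤ → Submodule K A) [DirectSum.Decomposition 𝒜] (δ : ZMod 2)
    {i : ℤ} {x : A} (hx : x ∈ 𝒜 i) : parityTwist 𝒜 δ x = psgn (δ * i) • x := by
  have h : (i : ZMod 2) = 0 ∨ (i : ZMod 2) = 1 := by
    generalize (i : ZMod 2) = j
    revert j
    decide
  simp only [parityTwist, LinearMap.add_apply, LinearMap.smul_apply, parityProj_apply 𝒜 _ hx]
  rcases h with h | h <;> simp [h, psgn]

/-- The total grading of `V ⊗ V`: degree `n` is spanned by `x ⊗ y` with `|x| + |y| = n`. -/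
def tensorGrading (𝒱 : ℤ → Submodule K V) (n : ℤ) : Submodule K (V ⊗[K] V) :=
  ⨆ i : ℤ, Submodule.map₂ (TensorProduct.mk K V V) (𝒱 i) (𝒱 (n - i))

theorem tmul_mem (𝒱 : ℤ → Submodule K V) {i j : ℤ} {x y : V} (hx : x ∈ 𝒱 i) (hy : y ∈ 𝒱 j) :
    x ⊗ₜ[K] y ∈ tensorGrading 𝒱 (i + j) := by
  refine Submodule.mem_iSup_of_mem i (Submodule.apply_mem_map₂ (TensorProduct.mk K V V) hx ?_)
  simpa using hy

theorem tensorGrading_le (𝒱 : ℤ → Submodule K V) {n : ℤ} {P : Submodule K (V ⊗[K] V)}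
    (h : ∀ i j x y, i + j = n → x ∈ 𝒱 i → y ∈ 𝒱 j → x ⊗ₜ[K] y ∈ P) : tensorGrading 𝒱 n ≤ P := by
  refine iSup_le fun i => Submodule.map₂_le.2 fun x hx y hy => ?_
  exact h i (n - i) x y (by ring) hx hy

/-- The map `V ⊗ V → ⨁ (V ⊗ V)_n` that splits a tensor into its homogeneous components. -/
def tensorDecompose (𝒱 : ℤ → Submodule K V) [DirectSum.Decomposition 𝒱] :
    V ⊗[K] V →ₗ[K] DirectSum ℤ fun n => tensorGrading 𝒱 n :=
  (DirectSum.toModule K (ℤ × ℤ) _ fun p =>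
      DirectSum.lof K ℤ (fun n => tensorGrading 𝒱 n) (p.1 + p.2) ∘ₗ
        TensorProduct.lift (LinearMap.mk₂ K
          (fun (x : 𝒱 p.1) (y : 𝒱 p.2) =>
            (⟨x ⊗ₜ[K] y, tmul_mem 𝒱 x.2 y.2⟩ : tensorGrading 𝒱 (p.1 + p.2)))
          (fun _ _ _ => Subtype.ext (by simp [TensorProduct.add_tmul]))
          (fun _ _ _ => Subtype.ext (by simp [TensorProduct.smul_tmul']))
          (fun _ _ _ => Subtype.ext (by simp [TensorProduct.tmul_add]))
          (fun _ _ _ => Subtype.ext (by simp)))) ∘ₗ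
    (TensorProduct.directSum K K (fun i => 𝒱 i) (fun i => 𝒱 i)).toLinearMap ∘ₗ
    (TensorProduct.congr (DirectSum.decomposeLinearEquiv 𝒱)
      (DirectSum.decomposeLinearEquiv 𝒱)).toLinearMap

theorem tensorDecompose_tmul (𝒱 : ℤ → Submodule K V) [DirectSum.Decomposition 𝒱] {i j : ℤ}
    {x y : V} (hx : x ∈ 𝒱 i) (hy : y ∈ 𝒱 j) :
    tensorDecompose 𝒱 (x ⊗ₜ[K] y) =
      DirectSum.lof K ℤ (fun n => tensorGrading 𝒱 n) (i + j) ⟨x ⊗ₜ[K] y, tmul_mem 𝒱 hx hy⟩ := by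
  lift x to 𝒱 i using hx
  lift y to 𝒱 j using hy
  simp only [tensorDecompose, LinearMap.comp_apply, LinearEquiv.coe_coe,
    TensorProduct.congr_tmul, DirectSum.decomposeLinearEquiv_apply_coe,
    TensorProduct.directSum_lof_tmul_lof, DirectSum.toModule_lof, TensorProduct.lift.tmul,
    LinearMap.mk₂_apply]

instance (𝒱 : ℤ → Submodule K V) [DirectSum.Decomposition 𝒱] :
    DirectSum.Decomposition (tensorGrading 𝒱) :=
  DirectSum.Decomposition.ofLinearMap _ (tensorDecompose 𝒱)
    (by
      refine TensorProduct.ext' fun x y => ?_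
      induction x using DirectSum.Decomposition.inductionOn 𝒱 with
      | zero => simp
      | add x x' hx hx' => rw [TensorProduct.add_tmul, map_add, map_add, hx, hx']
      | homogeneous x =>
        induction y using DirectSum.Decomposition.inductionOn 𝒱 with
        | zero => simp
        | add y y' hy hy' => rw [TensorProduct.tmul_add, map_add, map_add, hy, hy']
        | homogeneous y =>
          rw [LinearMap.comp_apply, tensorDecompose_tmul 𝒱 x.2 y.2, DirectSum.coeLinearMap_lof]
          rfl)
    (by
      refine DirectSum.linearMap_ext _ fun n => LinearMap.ext fun z => ?_
      obtain ⟨z, hz⟩ := z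
      have key : tensorGrading 𝒱 n ≤ LinearMap.eqLocus (tensorDecompose 𝒱)
          (DirectSum.lof K ℤ (fun n => tensorGrading 𝒱 n) n ∘ₗ
            DirectSum.component K ℤ (fun n => tensorGrading 𝒱 n) n ∘ₗ tensorDecompose 𝒱) := by
        refine tensorGrading_le 𝒱 fun i j x y hij hx hy => ?_
        subst hij
        rw [LinearMap.mem_eqLocus, LinearMap.comp_apply, LinearMap.comp_apply,
          tensorDecompose_tmul 𝒱 hx hy, DirectSum.component.lof_self]
      have key2 : tensorGrading 𝒱 n ≤ LinearMap.eqLocus LinearMap.id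
          ((tensorGrading 𝒱 n).subtype ∘ₗ DirectSum.component K ℤ (fun n => tensorGrading 𝒱 n) n ∘ₗ
            tensorDecompose 𝒱) := by
        refine tensorGrading_le 𝒱 fun i j x y hij hx hy => ?_
        subst hij
        rw [LinearMap.mem_eqLocus, LinearMap.comp_apply, LinearMap.comp_apply,
          tensorDecompose_tmul 𝒱 hx hy, DirectSum.component.lof_self]
        rfl
      have h1 := key hz
      have h2 := key2 hz
      rw [LinearMap.mem_eqLocus] at h1 h2
      simp only [LinearMap.comp_apply, LinearMap.id_apply, DirectSum.coeLinearMap_lof,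
        Submodule.subtype_apply] at h1 h2 ⊢
      rw [h1]
      congr 1
      exact Subtype.ext h2.symm)

/-- The suspension `sA`, with `(sA)_n = A_(n-1)`. The map `s : A → sA` is the identity of the
underlying vector space, of degree `1`. -/
def shift (𝒜 : ℤ → Submodule K A) (n : ℤ) : Submodule K A := 𝒜 (n - 1)

instance (𝒜 : ℤ → Submodule K A) [DirectSum.Decomposition 𝒜] :
    DirectSum.Decomposition (shift 𝒜) :=
  DirectSum.Decomposition.ofLinearMap _
    ((DirectSum.toModule K ℤ (DirectSum ℤ fun n => shift 𝒜 n) fun i =>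
      DirectSum.lof K ℤ (fun n => shift 𝒜 n) (i + 1) ∘ₗ
        Submodule.inclusion (show 𝒜 i ≤ shift 𝒜 (i + 1) by simp [shift])) ∘ₗ
      (DirectSum.decomposeLinearEquiv 𝒜).toLinearMap)
    (by
      refine LinearMap.ext fun x => ?_
      induction x using DirectSum.Decomposition.inductionOn 𝒜 with
      | zero => simp
      | add x x' hx hx' => rw [map_add, map_add, hx, hx']
      | homogeneous x => simp)
    (by
      refine DirectSum.linearMap_ext _ fun n => LinearMap.ext fun z => ?_
      obtain ⟨i, rfl⟩ : ∃ i, n = i + 1 := ⟨n - 1, by ring⟩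
      obtain ⟨z, hz⟩ := z
      have hz' : z ∈ 𝒜 i := by simpa [shift] using hz
      have : DirectSum.decompose 𝒜 z = DirectSum.lof K ℤ (fun n => 𝒜 n) i ⟨z, hz'⟩ :=
        DirectSum.decompose_of_mem 𝒜 hz'
      simp only [LinearMap.comp_apply, DirectSum.coeLinearMap_lof, LinearEquiv.coe_coe,
        DirectSum.decomposeLinearEquiv_apply, this, DirectSum.toModule_lof, LinearMap.id_apply]
      rfl)

/-! ### Graded Lie algebras -/

/-- The graded vector space `⨁ L n` (given by subspaces of a common ambient space `M`, so that
elements of equal degrees can be compared) with a bracket of degree `0` is a graded Lie algebra. -/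
structure IsGradedLieAlgebra {M : Type*} [AddCommGroup M] [Module K M] (L : ℤ → Submodule K M)
    (br : ∀ m n : ℤ, L m → L n → L (m + n)) : Prop where
  add_left : ∀ m n (x x' : L m) (y : L n), br m n (x + x') y = br m n x y + br m n x' y
  add_right : ∀ m n (x : L m) (y y' : L n), br m n x (y + y') = br m n x y + br m n x y'
  smul_left : ∀ m n (c : K) (x : L m) (y : L n), br m n (c • x) y = c • br m n x y
  smul_right : ∀ m n (c : K) (x : L m) (y : L n), br m n x (c • y) = c • br m n x y
  skew : ∀ m n (x : L m) (y : L n),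
    (br m n x y : M) = -(psgn ((m * n : ℤ) : ZMod 2) • (br n m y x : M))
  jacobi : ∀ m n p (x : L m) (y : L n) (z : L p),
    (br m (n + p) x (br n p y z) : M) =
      (br (m + n) p (br m n x y) z : M) +
        psgn ((m * n : ℤ) : ZMod 2) • (br n (m + p) y (br m p x z) : M)

/-- The degree `0` linear maps `φ n : L n → L' n` form a homomorphism of graded Lie algebras. -/
structure IsGradedLieHom {M M' : Type*} [AddCommGroup M] [Module K M]
    [AddCommGroup M'] [Module K M'] (L : ℤ → Submodule K M) (L' : ℤ → Submodule K M')
    (br : ∀ m n : ℤ, L m → L n → L (m + n)) (br' : ∀ m n : ℤ, L' m → L' n → L' (m + n))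
    (φ : ∀ n : ℤ, L n →ₗ[K] L' n) : Prop where
  source : IsGradedLieAlgebra L br
  target : IsGradedLieAlgebra L' br'
  map_bracket : ∀ m n (x : L m) (y : L n), φ (m + n) (br m n x y) = br' m n (φ m x) (φ n y)

/-- Maurer-Cartan elements (the differential is zero). -/
def IsMaurerCartan {M : Type*} [AddCommGroup M] [Module K M] (L : ℤ → Submodule K M)
    (br : ∀ m n : ℤ, L m → L n → L (m + n)) (x : L 1) : Prop :=
  br 1 1 x x = 0

/-! ### The graded Balavoine algebra -/

/-- A family of linear maps `f a : A^{⊗(a+1)} → A`, one for each `a ≥ 0`. -/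
abbrev Family (K A : Type*) [Field K] [AddCommGroup A] [Module K A] : Type _ :=
  ∀ a : ℕ, MultilinearMap K (fun _ : Fin (a + 1) => A) A

/-- The space of degree `n` linear maps from the reduced tensor space
`⨁_{i ≥ 1} A^{⊗i}` to `A`. -/
def CL (𝒜 : ℤ → Submodule K A) (n : ℤ) : Submodule K (Family K A) where
  carrier := {f | ∀ (a : ℕ) (d : Fin (a + 1) → ℤ) (v : Fin (a + 1) → A),
    (∀ i, v i ∈ 𝒜 (d i)) → f a v ∈ 𝒜 ((∑ i, d i) + n)}
  zero_mem' := fun _ _ _ _ => zero_mem _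
  add_mem' := fun hf hg a d v hv => add_mem (hf a d v hv) (hg a d v hv)
  smul_mem' := fun c _ hf a d v hv => Submodule.smul_mem _ c (hf a d v hv)

/-- With indices starting from `0`, the list
`w_0, …, w_{c-1}, G(w_c, …, w_{c+b}), w_{c+b+1}, …, w_N` of `a + 1` elements, where `a + b = N`. -/
def insertArgs {a b c N : ℕ} (h : a + b = N) (hc : c ≤ a)
    (G : MultilinearMap K (fun _ : Fin (b + 1) => A) A) (w : Fin (N + 1) → A) (r : Fin (a + 1)) :
    A :=
  if (r : ℕ) < c then w ⟨r, by omega⟩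
  else if (r : ℕ) = c then G fun t => w ⟨c + t, by omega⟩
  else w ⟨r + b, by omega⟩

theorem insertArgs_update_cases {a b c N : ℕ} (h : a + b = N) (hc : c ≤ a)
    (G : MultilinearMap K (fun _ : Fin (b + 1) => A) A) (w : Fin (N + 1) → A) (p : Fin (N + 1)) :
    (∃ r : Fin (a + 1), ∀ x, insertArgs h hc G (Function.update w p x) =
      Function.update (insertArgs h hc G w) r x) ∨
    (∃ (r : Fin (a + 1)) (t : Fin (b + 1)), ∀ x, insertArgs h hc G (Function.update w p x) =
      Function.update (insertArgs h hc G w) r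
        (G (Function.update (fun t : Fin (b + 1) => w ⟨c + t, by omega⟩) t x))) := by
  obtain ⟨p, hp⟩ := p
  have hG : (p < c ∨ c + b < p) → ∀ x, (fun t : Fin (b + 1) =>
      Function.update w ⟨p, hp⟩ x ⟨c + t, by omega⟩) = fun t : Fin (b + 1) => w ⟨c + t, by omega⟩ := by
    intro h' x
    funext t
    rw [Function.update_of_ne]
    simp only [ne_eq, Fin.mk.injEq]
    omega
  rcases lt_or_ge p c with h1 | h1
  · refine Or.inl ⟨⟨p, by omega⟩, fun x => funext fun r => ?_⟩
    simp only [insertArgs, hG (Or.inl h1)]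
    simp only [Function.update_apply, Fin.ext_iff, insertArgs]
    split_ifs <;> first | rfl | omega
  · rcases lt_or_ge (c + b) p with h2 | h2
    · refine Or.inl ⟨⟨p - b, by omega⟩, fun x => funext fun r => ?_⟩
      simp only [insertArgs, hG (Or.inr h2)]
      simp only [Function.update_apply, Fin.ext_iff, insertArgs]
      split_ifs <;> first | rfl | omega
    · refine Or.inr ⟨⟨c, by omega⟩, ⟨p - c, by omega⟩, fun x => funext fun r => ?_⟩
      have hG' : (fun t : Fin (b + 1) => Function.update w ⟨p, hp⟩ x ⟨c + t, by omega⟩) =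
          Function.update (fun t : Fin (b + 1) => w ⟨c + t, by omega⟩) ⟨p - c, by omega⟩ x := by
        funext t
        simp only [Function.update_apply, Fin.ext_iff]
        split_ifs <;> first | rfl | omega
      simp only [insertArgs, hG']
      simp only [Function.update_apply, Fin.ext_iff, insertArgs]
      split_ifs <;> first | rfl | omega

/-- The map
`(w_0, …, w_N) ↦ F(w_0, …, w_{c-1}, G(w_c, …, w_{c+b}), w_{c+b+1}, …, w_N)`. -/
def insertAt {a b c N : ℕ} (h : a + b = N) (hc : c ≤ a)
    (F : MultilinearMap K (fun _ : Fin (a + 1) => A) A)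
    (G : MultilinearMap K (fun _ : Fin (b + 1) => A) A) :
    MultilinearMap K (fun _ : Fin (N + 1) => A) A :=
  MultilinearMap.mk' (fun w => F (insertArgs h hc G w))
    (fun w p x y => by
      rcases insertArgs_update_cases h hc G w p with ⟨r, hr⟩ | ⟨r, t, hr⟩
      · rw [hr, hr, hr, MultilinearMap.map_update_add]
      · rw [hr, hr, hr, MultilinearMap.map_update_add, MultilinearMap.map_update_add])
    (fun w p k x => by
      rcases insertArgs_update_cases h hc G w p with ⟨r, hr⟩ | ⟨r, t, hr⟩
      · rw [hr, hr, MultilinearMap.map_update_smul]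
      · rw [hr, hr, MultilinearMap.map_update_smul, MultilinearMap.map_update_smul])

theorem sum_insert {a b c N : ℕ} (h : a + b = N) (hc : c ≤ a) (d : Fin (N + 1) → ℤ) (n : ℤ) :
    (∑ r : Fin (a + 1), if (r : ℕ) < c then d ⟨r, by omega⟩
      else if (r : ℕ) = c then (∑ t : Fin (b + 1), d ⟨c + t, by omega⟩) + n
      else d ⟨r + b, by omega⟩) = (∑ i, d i) + n := by
  obtain ⟨D, hD⟩ : ∃ D : ℕ → ℤ, ∀ i (hi : i < N + 1), d ⟨i, hi⟩ = D i :=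
    ⟨fun i => if hi : i < N + 1 then d ⟨i, hi⟩ else 0, fun i hi => by simp [hi]⟩
  have h0 : ∑ i, d i = ∑ i ∈ Finset.range (N + 1), D i := by
    rw [← Fin.sum_univ_eq_sum_range]
    exact Finset.sum_congr rfl fun i _ => hD i i.2
  rw [h0]
  simp only [hD]
  rw [Fin.sum_univ_eq_sum_range (fun t => D (c + t)) (b + 1),
    Fin.sum_univ_eq_sum_range (fun r => if r < c then D r else if r = c then
      (∑ t ∈ Finset.range (b + 1), D (c + t)) + n else D (r + b)) (a + 1)]
  obtain ⟨k, rfl⟩ := Nat.exists_eq_add_of_le hc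
  subst h
  rw [show c + k + 1 = c + (1 + k) by ring, show c + k + b + 1 = c + (b + 1 + k) by ring,
    Finset.sum_range_add _ c, Finset.sum_range_add _ 1, Finset.sum_range_add _ c,
    Finset.sum_range_add _ (b + 1) k,
    Finset.sum_congr rfl fun x hx => if_pos (Finset.mem_range.1 hx)]
  have h3 : ∀ x ∈ Finset.range k, (if c + (1 + x) < c then D (c + (1 + x)) else
      if c + (1 + x) = c then (∑ t ∈ Finset.range (b + 1), D (c + t)) + n
      else D (c + (1 + x) + b)) = D (c + (b + 1 + x)) := fun x _ => by
    rw [if_neg (by omega), if_neg (by omega)]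
    congr 1
    ring
  rw [Finset.sum_congr rfl h3]
  simp only [Finset.sum_range_one, add_zero, lt_self_iff_false, if_false, if_true]
  ring

theorem insertAt_mem (𝒜 : ℤ → Submodule K A) {m n : ℤ} {a b c N : ℕ} (h : a + b = N) (hc : c ≤ a)
    {F : MultilinearMap K (fun _ : Fin (a + 1) => A) A}
    {G : MultilinearMap K (fun _ : Fin (b + 1) => A) A}
    (hF : ∀ (d : Fin (a + 1) → ℤ) (v : Fin (a + 1) → A),
      (∀ i, v i ∈ 𝒜 (d i)) → F v ∈ 𝒜 ((∑ i, d i) + m))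
    (hG : ∀ (d : Fin (b + 1) → ℤ) (v : Fin (b + 1) → A),
      (∀ i, v i ∈ 𝒜 (d i)) → G v ∈ 𝒜 ((∑ i, d i) + n))
    (d : Fin (N + 1) → ℤ) (w : Fin (N + 1) → A) (hw : ∀ i, w i ∈ 𝒜 (d i)) :
    insertAt h hc F G w ∈ 𝒜 ((∑ i, d i) + (m + n)) := by
  have := hF (v := insertArgs h hc G w) (d := fun r : Fin (a + 1) => if (r : ℕ) < c then
      d ⟨r, by omega⟩ else if (r : ℕ) = c then (∑ t : Fin (b + 1), d ⟨c + t, by omega⟩) + n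
      else d ⟨r + b, by omega⟩) (fun r => by
    simp only [insertArgs]
    split_ifs
    · exact hw _
    · exact hG _ _ fun t => hw _
    · exact hw _)
  rw [sum_insert h hc d n] at this
  rwa [add_assoc, add_comm n m] at this

/-- The `(c, b)`-shuffles, as permutations of `{0, …, N}` that fix all `p ≥ c + b`. -/
def shuffles (c b N : ℕ) : Finset (Equiv.Perm (Fin (N + 1))) :=
  Finset.univ.filter fun σ =>
    (∀ p q : Fin (N + 1), p < q → (q : ℕ) < c → σ p < σ q) ∧
    (∀ p q : Fin (N + 1), c ≤ (p : ℕ) → p < q → (q : ℕ) < c + b → σ p < σ q) ∧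
    (∀ p : Fin (N + 1), c + b ≤ (p : ℕ) → σ p = p)

/-- The exponent of the Koszul sign `ε(σ; v_0, …, v_N)` that arises when `v_0 ⋯ v_N` is reordered
into `v_{σ(0)} ⋯ v_{σ(N)}`, where `v_i` has parity `d i`. -/
def koszulExp {N : ℕ} (σ : Equiv.Perm (Fin N)) (d : Fin N → ZMod 2) : ZMod 2 :=
  ∑ p : Fin N, ∑ q : Fin N, if p < q ∧ σ q < σ p then d (σ p) * d (σ q) else 0

theorem sum_parityProj {B ι : Type*} [AddCommGroup B] [Module K B] [Fintype ι] [DecidableEq ι]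
    (𝒜 : ℤ → Submodule K A) [DirectSum.Decomposition 𝒜] (M : (ι → ZMod 2) →
    MultilinearMap K (fun _ : ι => A) B) (e : ι → ℤ) (v : ι → A) (hv : ∀ i, v i ∈ 𝒜 (e i)) :
    ∑ d : ι → ZMod 2, M d (fun i => parityProj 𝒜 (d i) (v i)) =
      M (fun i => (e i : ZMod 2)) v := by
  rw [Finset.sum_eq_single (fun i => (e i : ZMod 2))]
  · congr 1
    funext i
    simp [parityProj_apply 𝒜 _ (hv i)]
  · intro d _ hd
    obtain ⟨i, hi⟩ := Function.ne_iff.1 hd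
    refine (M d).map_coord_zero i ?_
    rw [parityProj_apply 𝒜 _ (hv i), if_neg hi.symm]
  · simp

/-- The operation `F ∘_{c+1} G`, where `G` has degree `n`. The sum over `d` splits the arguments
into their parity components. On homogeneous arguments `v_i` this is
`∑_σ (-1)^β ε(σ) F(v_{σ(0)}, …, v_{σ(c-1)}, G(v_{σ(c)}, …, v_{σ(c+b-1)}, v_{c+b}), v_{c+b+1}, …, v_N)`
with `σ` running over the `(c, b)`-shuffles and `β = n (|v_{σ(0)}| + ⋯ + |v_{σ(c-1)}|)`. -/
def circAt (𝒜 : ℤ → Submodule K A) [DirectSum.Decomposition 𝒜] (n : ℤ) {a b c N : ℕ}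
    (h : a + b = N) (hc : c ≤ a)
    (F : MultilinearMap K (fun _ : Fin (a + 1) => A) A)
    (G : MultilinearMap K (fun _ : Fin (b + 1) => A) A) :
    MultilinearMap K (fun _ : Fin (N + 1) => A) A :=
  ∑ σ ∈ shuffles c b N, ∑ d : Fin (N + 1) → ZMod 2,
    psgn (koszulExp σ d + n * ∑ p : Fin (N + 1), if (p : ℕ) < c then d (σ p) else 0) •
      ((insertAt h hc F G).domDomCongr σ).compLinearMap fun i => parityProj 𝒜 (d i)

theorem circAt_apply (𝒜 : ℤ → Submodule K A) [DirectSum.Decomposition 𝒜] (n : ℤ) {a b c N : ℕ}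
    (h : a + b = N) (hc : c ≤ a)
    (F : MultilinearMap K (fun _ : Fin (a + 1) => A) A)
    (G : MultilinearMap K (fun _ : Fin (b + 1) => A) A)
    (e : Fin (N + 1) → ℤ) (v : Fin (N + 1) → A) (hv : ∀ i, v i ∈ 𝒜 (e i)) :
    circAt 𝒜 n h hc F G v = ∑ σ ∈ shuffles c b N,
      psgn (koszulExp σ (fun i => (e i : ZMod 2)) +
        n * ∑ p : Fin (N + 1), if (p : ℕ) < c then (e (σ p) : ZMod 2) else 0) •
      insertAt h hc F G fun i => v (σ i) := by
  simp only [circAt, sum_apply]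
  refine Finset.sum_congr rfl fun σ _ => ?_
  exact sum_parityProj 𝒜 (fun d => psgn (koszulExp σ d + n * ∑ p : Fin (N + 1),
    if (p : ℕ) < c then d (σ p) else 0) • (insertAt h hc F G).domDomCongr σ) e v hv

/-- The composition `f ∘̄ g`, where `g` has degree `n`: its component of arity `N + 1` is the sum of
all `f_i ∘_k g_j` with `i + j = N + 2` and `1 ≤ k ≤ i`. -/
def circ (𝒜 : ℤ → Submodule K A) [DirectSum.Decomposition 𝒜] (n : ℤ) (f g : Family K A) :
    Family K A := fun N =>
  ∑ p ∈ (Finset.HasAntidiagonal.antidiagonal N).attach, ∑ c : Fin (p.1.1 + 1),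
    circAt 𝒜 n (Finset.HasAntidiagonal.mem_antidiagonal.1 p.2) (Nat.lt_succ_iff.1 c.2) (f p.1.1) (g p.1.2)

theorem circ_mem (𝒜 : ℤ → Submodule K A) [DirectSum.Decomposition 𝒜] {m n : ℤ}
    {f g : Family K A} (hf : f ∈ CL 𝒜 m) (hg : g ∈ CL 𝒜 n) : circ 𝒜 n f g ∈ CL 𝒜 (m + n) := by
  intro N d v hv
  simp only [circ, sum_apply]
  refine sum_mem fun p _ => sum_mem fun c _ => ?_
  rw [circAt_apply 𝒜 n _ _ _ _ d v hv]
  refine sum_mem fun σ _ => zsmul_mem ?_ _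
  rw [← Equiv.sum_comp σ d]
  exact insertAt_mem 𝒜 _ _ (hf _) (hg _) _ _ fun i => hv _

/-- The graded Balavoine bracket `[f, g] = f ∘̄ g - (-1)^(mn) g ∘̄ f`. -/
def balavoineBracket (𝒜 : ℤ → Submodule K A) [DirectSum.Decomposition 𝒜] (m n : ℤ)
    (f : CL 𝒜 m) (g : CL 𝒜 n) : CL 𝒜 (m + n) :=
  ⟨circ 𝒜 n f g - psgn ((m * n : ℤ) : ZMod 2) • circ 𝒜 m g f,
    sub_mem (circ_mem 𝒜 f.2 g.2)
      (zsmul_mem (add_comm n m ▸ circ_mem 𝒜 g.2 f.2) _)⟩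

/-- A Leibniz-infinity-algebra structure on the graded vector space `A`: a collection of linear
maps `ℓ k : A^{⊗(k+1)} → A` of degree `1` that is a Maurer-Cartan element of the graded Balavoine
algebra. -/
def IsLeibnizInfinity (𝒜 : ℤ → Submodule K A) [DirectSum.Decomposition 𝒜] (ℓ : CL 𝒜 1) : Prop :=
  IsMaurerCartan (CL 𝒜) (balavoineBracket 𝒜) ℓ

/-! ### Homotopy Nambu algebras -/

/-- A family of linear maps `f a : (V ⊗ V)^{⊗a} ⊗ V → V`, one for each `a ≥ 0` (the last argument
is curried). The map `f a` is the component that takes `2a + 1` arguments from `V`. -/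
abbrev NambuFamily (K V : Type*) [Field K] [AddCommGroup V] [Module K V] : Type _ :=
  ∀ a : ℕ, MultilinearMap K (fun _ : Fin a => V ⊗[K] V) (V →ₗ[K] V)

/-- The families for which `f a : (V ⊗ V)^{⊗a} ⊗ V → V` has degree `n + a`. -/
def CV (𝒱 : ℤ → Submodule K V) (n : ℤ) : Submodule K (NambuFamily K V) where
  carrier := {f | ∀ (a : ℕ) (d : Fin a → ℤ) (e : ℤ) (X : Fin a → V ⊗[K] V) (x : V),
    (∀ i, X i ∈ tensorGrading 𝒱 (d i)) → x ∈ 𝒱 e → f a X x ∈ 𝒱 ((∑ i, d i) + e + (n + a))}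
  zero_mem' := fun _ _ _ _ _ _ _ => zero_mem _
  add_mem' := fun hf hg a d e X x hX hx => add_mem (hf a d e X x hX hx) (hg a d e X x hX hx)
  smul_mem' := fun c _ hf a d e X x hX hx => Submodule.smul_mem _ c (hf a d e X x hX hx)

/-- The map `(V ⊗ V)^{⊗(a+1)} → V ⊗ V` attached to `F : (V ⊗ V)^{⊗a} ⊗ V → V` of degree `n + a`:
on homogeneous arguments,
`(X_1, …, X_a, x ⊗ y) ↦ F(X_1, …, X_a, x) ⊗ y + (-1)^(|x|(|X_1| + ⋯ + |X_a| + n + a)) x ⊗ F(X_1, …, X_a, y)`. -/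
def leibnizExt (𝒱 : ℤ → Submodule K V) [DirectSum.Decomposition 𝒱] (n : ℤ) (a : ℕ)
    (F : MultilinearMap K (fun _ : Fin a => V ⊗[K] V) (V →ₗ[K] V)) :
    MultilinearMap K (fun _ : Fin (a + 1) => V ⊗[K] V) (V ⊗[K] V) :=
  MultilinearMap.uncurryRight
    ((LinearMap.rTensorHom V).compMultilinearMap F +
      ∑ d : Fin a → ZMod 2,
        (TensorProduct.mapBilinear (RingHom.id K) V V V V
          (parityTwist 𝒱 ((∑ i, d i) + n + a))).compMultilinearMap
          (F.compLinearMap fun i => parityProj (tensorGrading 𝒱) (d i)))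

/-- Homogeneous arguments are evaluated by the expected formula. -/
theorem leibnizExt_apply (𝒱 : ℤ → Submodule K V) [DirectSum.Decomposition 𝒱] (n : ℤ) (a : ℕ)
    (F : MultilinearMap K (fun _ : Fin a => V ⊗[K] V) (V →ₗ[K] V)) (d : Fin a → ℤ) (e : ℤ)
    (X : Fin a → V ⊗[K] V) (x y : V) (hX : ∀ i, X i ∈ tensorGrading 𝒱 (d i)) (hx : x ∈ 𝒱 e) :
    leibnizExt 𝒱 n a F (Fin.snoc X (x ⊗ₜ[K] y)) =
      F X x ⊗ₜ[K] y + psgn ((e * ((∑ i, d i) + n + a) : ℤ) : ZMod 2) • (x ⊗ₜ[K] F X y) := by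
  have key := sum_parityProj (tensorGrading 𝒱)
    (fun d : Fin a → ZMod 2 => ((LinearMap.applyₗ (R := K) (x ⊗ₜ[K] y)) ∘ₗ
      TensorProduct.mapBilinear (RingHom.id K) V V V V
        (parityTwist 𝒱 ((∑ i, d i) + n + a))).compMultilinearMap F) d X hX
  simp only [LinearMap.compMultilinearMap_apply, LinearMap.comp_apply, LinearMap.applyₗ_apply_apply,
    TensorProduct.mapBilinear_apply, TensorProduct.map_tmul, parityTwist_apply 𝒱 _ hx] at key
  simp only [leibnizExt, MultilinearMap.uncurryRight_apply, Fin.init_snoc, Fin.snoc_last,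
    add_apply, LinearMap.add_apply, sum_apply, LinearMap.sum_apply,
    LinearMap.compMultilinearMap_apply, MultilinearMap.compLinearMap_apply,
    TensorProduct.mapBilinear_apply, TensorProduct.map_tmul, parityTwist_apply 𝒱 _ hx,
    LinearMap.coe_rTensorHom, LinearMap.rTensor_tmul]
  rw [key, TensorProduct.smul_tmul']
  push_cast
  rw [mul_comm]

theorem leibnizExt_add (𝒱 : ℤ → Submodule K V) [DirectSum.Decomposition 𝒱] (n : ℤ) (a : ℕ)
    (F G : MultilinearMap K (fun _ : Fin a => V ⊗[K] V) (V →ₗ[K] V)) :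
    leibnizExt 𝒱 n a (F + G) = leibnizExt 𝒱 n a F + leibnizExt 𝒱 n a G := by
  ext v
  simp only [leibnizExt, MultilinearMap.uncurryRight_apply, add_apply,
    LinearMap.add_apply, sum_apply, LinearMap.sum_apply,
    LinearMap.compMultilinearMap_apply, MultilinearMap.compLinearMap_apply, map_add,
    Finset.sum_add_distrib]
  abel

theorem leibnizExt_smul (𝒱 : ℤ → Submodule K V) [DirectSum.Decomposition 𝒱] (n : ℤ) (a : ℕ)
    (c : K) (F : MultilinearMap K (fun _ : Fin a => V ⊗[K] V) (V →ₗ[K] V)) :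
    leibnizExt 𝒱 n a (c • F) = c • leibnizExt 𝒱 n a F := by
  ext v
  simp only [leibnizExt, MultilinearMap.uncurryRight_apply, add_apply,
    LinearMap.add_apply, sum_apply, LinearMap.sum_apply,
    LinearMap.compMultilinearMap_apply, MultilinearMap.compLinearMap_apply, map_smul,
    smul_apply, LinearMap.smul_apply, Finset.smul_sum, smul_add]

theorem leibnizExt_mem (𝒱 : ℤ → Submodule K V) [DirectSum.Decomposition 𝒱] {n : ℤ}
    {f : NambuFamily K V} (hf : f ∈ CV 𝒱 n) :
    (fun a => (-1 : ℤ) ^ ((a + 1) * a / 2) • leibnizExt 𝒱 n a (f a)) ∈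
      CL (shift (tensorGrading 𝒱)) n := by
  intro a d v hv
  refine zsmul_mem ?_ _
  obtain ⟨X, w, rfl⟩ : ∃ (X : Fin a → V ⊗[K] V) (w : V ⊗[K] V),
      v = (Fin.snoc X w : Fin (a + 1) → V ⊗[K] V) :=
    ⟨Fin.init v, v (Fin.last a), (Fin.snoc_init_self v).symm⟩
  have hX : ∀ i, X i ∈ tensorGrading 𝒱 (d i.castSucc - 1) := fun i => by
    simpa [shift] using hv i.castSucc
  have hw : w ∈ tensorGrading 𝒱 (d (Fin.last a) - 1) := by
    simpa [shift] using hv (Fin.last a)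
  have hle : tensorGrading 𝒱 (d (Fin.last a) - 1) ≤
      (shift (tensorGrading 𝒱) ((∑ i, d i) + n)).comap
        ((leibnizExt 𝒱 n a (f a)).curryRight X) := by
    refine tensorGrading_le 𝒱 fun i j x y hij hx hy => ?_
    have hs : ∑ k : Fin a, (d k.castSucc - 1) = (∑ k, d k) - d (Fin.last a) - a := by
      rw [Fin.sum_univ_castSucc d, Finset.sum_sub_distrib]
      simp
    rw [Submodule.mem_comap, MultilinearMap.curryRight_apply,
      leibnizExt_apply 𝒱 n a (f a) _ i X x y hX hx, shift]
    have h1 := tmul_mem 𝒱 (hf a _ _ X x hX hx) hy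
    have h2 := tmul_mem 𝒱 hx (hf a _ _ X y hX hy)
    rw [hs] at h1 h2
    rw [show (∑ k, d k) - d (Fin.last a) - a + i + (n + a) + j = (∑ k, d k) + n - 1 by
      linear_combination hij] at h1
    rw [show i + ((∑ k, d k) - d (Fin.last a) - a + j + (n + a)) = (∑ k, d k) + n - 1 by
      linear_combination hij] at h2
    exact add_mem h1 (zsmul_mem h2 _)
  exact hle hw

/-- The map `Ψ` from `CV^n(V, V)` to `CL^n(s(V ⊗ V), s(V ⊗ V))`. On its `p`-th component,
`p = a + 1`, it is `(-1)^(p(p-1)/2)` times the extension above; the suspension `s` is the identity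
of the underlying vector space. -/
def Psi (𝒱 : ℤ → Submodule K V) [DirectSum.Decomposition 𝒱] (n : ℤ) :
    CV 𝒱 n →ₗ[K] CL (shift (tensorGrading 𝒱)) n where
  toFun f := ⟨fun a => (-1 : ℤ) ^ ((a + 1) * a / 2) • leibnizExt 𝒱 n a (f.1 a),
    leibnizExt_mem 𝒱 f.2⟩
  map_add' f g := Subtype.ext <| funext fun a => by
    simp only [Submodule.coe_add, Pi.add_apply, leibnizExt_add, smul_add]
  map_smul' c f := Subtype.ext <| funext fun a => by
    simp only [Submodule.coe_smul, Pi.smul_apply, leibnizExt_smul, RingHom.id_apply]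
    rw [smul_comm]

/-- The bracket `⟦f, g⟧ = Ψ⁻¹([Ψ f, Ψ g])` on `CV`. -/
def nambuBracket (𝒱 : ℤ → Submodule K V) [DirectSum.Decomposition 𝒱] (m n : ℤ)
    (f : CV 𝒱 m) (g : CV 𝒱 n) : CV 𝒱 (m + n) :=
  Function.invFun (Psi 𝒱 (m + n))
    (balavoineBracket (shift (tensorGrading 𝒱)) m n (Psi 𝒱 m f) (Psi 𝒱 n g))

/-- A homotopy Nambu algebra structure on `V`: a collection of linear maps
`π k : (V ⊗ V)^{⊗k} ⊗ V → V` of degree `k + 1` that is a Maurer-Cartan element. -/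
def IsHomotopyNambu (𝒱 : ℤ → Submodule K V) [DirectSum.Decomposition 𝒱] (π : CV 𝒱 1) : Prop :=
  IsMaurerCartan (CV 𝒱) (nambuBracket 𝒱) π

end HomotopyNambu
end

/-!
Write `ι_x f` for the family `w ↦ f (x, w)` and `f₁` for the unary component of `f`. For `g` of
degree `n` and `x` of degree `i`, splitting the shuffles by the position of the first argument
turns the definition of `f ∘̄ g` into the recursion
`(f ∘̄ g)₁ = f₁ ∘ g₁`, `ι_x (f ∘̄ g) = ι_{g₁ x} f + (-1)^(n i) (ι_x f) ∘̄ g + f ∘̄ (ι_x g)`.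
As a family is determined by its unary component and its contractions, induction on the arity shows
that the associator of `∘̄` is graded symmetric in its last two arguments. So `∘̄` is a graded
pre-Lie product, and its commutator, the Balavoine bracket, is a graded Lie bracket.

The image of `Ψ` consists of the families that are derivations of `V ⊗ V` in their last argument,
and the recursion, with the fact that derivations are closed under commutators, shows that these
families are closed under the bracket. A derivation extending `T` determines `T`: if
`T x ⊗ x ± x ⊗ T x = 0`, then `T x` is a multiple of `x`, so it vanishes if `T` is odd, and if `T`
is even the sign is `+` and it vanishes as `2 ≠ 0`. Hence `Ψ` is injective and the graded Lie
structure can be pulled back along it.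
-/

noncomputable section

namespace HomotopyNambu

theorem psgn_add (x y : ZMod 2) : psgn (x + y) = psgn x * psgn y := by
  revert x y
  decide

theorem psgn_eq_one_or_neg_one (x : ZMod 2) : psgn x = 1 ∨ psgn x = -1 := by
  revert x
  decide

section HomogeneousExt

variable {ι R M B : Type*} [DecidableEq ι] [CommSemiring R] [AddCommMonoid M] [Module R M]
  [AddCommMonoid B] [Module R B] (ℳ : ι → Submodule R M) [DirectSum.Decomposition ℳ]

theorem linearMap_ext_homogeneous {F G : M →ₗ[R] B} (h : ∀ i, ∀ x ∈ ℳ i, F x = G x) : F = G :=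
  DirectSum.decompose_lhom_ext ℳ fun i => LinearMap.ext fun x => h i x x.2

theorem multilinearMap_ext_homogeneous {N : ℕ} {F G : MultilinearMap R (fun _ : Fin N => M) B}
    (h : ∀ (d : Fin N → ι) (v : Fin N → M), (∀ j, v j ∈ ℳ (d j)) → F v = G v) : F = G := by
  induction N with
  | zero => exact MultilinearMap.ext fun v => h Fin.elim0 v fun j => j.elim0
  | succ N ih =>
    refine (multilinearCurryLeftEquiv R (fun _ => M) B).injective ?_
    refine linearMap_ext_homogeneous ℳ fun i x hx => ih fun d v hv => ?_
    exact h (Fin.cons i d) (Fin.cons x v) (Fin.cases hx hv)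

theorem tensor_ext_homogeneous {M' : Type*} [AddCommMonoid M'] [Module R M']
    {F G : M ⊗[R] M' →ₗ[R] B} (h : ∀ i, ∀ x ∈ ℳ i, ∀ y, F (x ⊗ₜ[R] y) = G (x ⊗ₜ[R] y)) :
    F = G :=
  TensorProduct.ext <| linearMap_ext_homogeneous ℳ fun i x hx => LinearMap.ext fun y => h i x hx y

end HomogeneousExt

section GradedLie

variable {K M M' : Type*} [Field K] [AddCommGroup M] [Module K M] [AddCommGroup M'] [Module K M']
  {L : ℤ → Submodule K M} {L' : ℤ → Submodule K M'}
  {br : ∀ m n : ℤ, L m → L n → L (m + n)} {br' : ∀ m n : ℤ, L' m → L' n → L' (m + n)}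

/-- The associator `(x ∘ y) ∘ z - x ∘ (y ∘ z)` of elements `y` and `z` of degrees `n` and `p`.
The product `x ∘ y` may depend on the degree `n` of its right factor: it is `comp n x y`. -/
def gradedAssociator (comp : ℤ → M →ₗ[K] M →ₗ[K] M) (n p : ℤ) (x y z : M) : M :=
  comp p (comp n x y) z - comp (n + p) x (comp p y z)

/-- The product `x ∘ y = comp n x y`, for `y` of degree `n`, is a graded right pre-Lie product on
`⨁ L n`: its associator is graded symmetric in the last two arguments. -/
def IsGradedPreLie (L : ℤ → Submodule K M) (comp : ℤ → M →ₗ[K] M →ₗ[K] M) : Prop :=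
  ∀ (m n p : ℤ) (x : L m) (y : L n) (z : L p),
    gradedAssociator comp n p x y z =
      psgn ((n * p : ℤ) : ZMod 2) • gradedAssociator comp p n (x : M) z y

/-- The graded commutator `x ∘ y - (-1)^(mn) y ∘ x` of elements of degrees `m` and `n`. -/
def gradedCommutator (comp : ℤ → M →ₗ[K] M →ₗ[K] M) (m n : ℤ) (x y : M) : M :=
  comp n x y - psgn ((m * n : ℤ) : ZMod 2) • comp m y x

theorem IsGradedPreLie.jacobi {comp : ℤ → M →ₗ[K] M →ₗ[K] M} (h : IsGradedPreLie L comp)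
    {m n p : ℤ} (x : L m) (y : L n) (z : L p) :
    gradedCommutator comp m (n + p) x (gradedCommutator comp n p (y : M) z) =
      gradedCommutator comp (m + n) p (gradedCommutator comp m n (x : M) y) z +
        psgn ((m * n : ℤ) : ZMod 2) •
          gradedCommutator comp n (m + p) y (gradedCommutator comp m p (x : M) z) := by
  have hx := h m n p x y z
  have hy := congrArg (psgn (m * n) • ·) (h n m p y x z)
  have hz := congrArg ((psgn (m * p) * psgn (n * p)) • ·) (h p m n z x y)
  simp only [gradedCommutator, gradedAssociator, map_sub, map_zsmul, LinearMap.sub_apply,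
    LinearMap.smul_apply, add_comm n m, add_comm p n, add_comm p m, Int.cast_mul, Int.cast_add,
    mul_add, add_mul, psgn_add, mul_comm (n : ZMod 2) m] at hx hy hz ⊢
  rcases psgn_eq_one_or_neg_one (m * n) with hmn | hmn <;>
  rcases psgn_eq_one_or_neg_one (m * p) with hmp | hmp <;>
  rcases psgn_eq_one_or_neg_one (n * p) with hnp | hnp <;>
  simp only [hmn, hmp, hnp] at hx hy hz ⊢ <;>
  linear_combination (norm := module) hy - hx - hz

theorem IsGradedPreLie.isGradedLieAlgebra {comp : ℤ → M →ₗ[K] M →ₗ[K] M}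
    (h : IsGradedPreLie L comp)
    (hbr : ∀ m n (x : L m) (y : L n), (br m n x y : M) = gradedCommutator comp m n (x : M) y) :
    IsGradedLieAlgebra L br where
  add_left m n x x' y := Subtype.ext <| by
    simp only [hbr, gradedCommutator, Submodule.coe_add, map_add, LinearMap.add_apply]
    module
  add_right m n x y y' := Subtype.ext <| by
    simp only [hbr, gradedCommutator, Submodule.coe_add, map_add, LinearMap.add_apply]
    module
  smul_left m n c x y := Subtype.ext <| by
    simp only [hbr, gradedCommutator, Submodule.coe_smul, map_smul, LinearMap.smul_apply]
    module
  smul_right m n c x y := Subtype.ext <| by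
    simp only [hbr, gradedCommutator, Submodule.coe_smul, map_smul, LinearMap.smul_apply]
    module
  skew m n x y := by
    rw [hbr, hbr, gradedCommutator, gradedCommutator, mul_comm n m]
    rcases psgn_eq_one_or_neg_one (m * n : ℤ) with hs | hs <;> rw [hs] <;> module
  jacobi m n p x y z := by
    simp only [hbr]
    exact h.jacobi x y z

theorem gradedMap_cast (φ : ∀ n : ℤ, L n →ₗ[K] L' n) {k l : ℤ} (h : k = l) (x : L k) :
    φ l ⟨x, h ▸ x.2⟩ = ⟨φ k x, h ▸ (φ k x).2⟩ := by
  subst h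
  rfl

theorem IsGradedLieAlgebra.of_injective (h : IsGradedLieAlgebra L' br')
    (φ : ∀ n : ℤ, L n →ₗ[K] L' n) (hφ : ∀ n, Function.Injective (φ n))
    (hbr : ∀ m n (x : L m) (y : L n), φ (m + n) (br m n x y) = br' m n (φ m x) (φ n y)) :
    IsGradedLieAlgebra L br where
  add_left m n x x' y := hφ _ <| by simp only [map_add, hbr, h.add_left]
  add_right m n x y y' := hφ _ <| by simp only [map_add, hbr, h.add_right]
  smul_left m n c x y := hφ _ <| by simp only [map_smul, hbr, h.smul_left]
  smul_right m n c x y := hφ _ <| by simp only [map_smul, hbr, h.smul_right]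
  skew m n x y := by
    let yx : L (m + n) := ⟨br n m y x, add_comm n m ▸ (br n m y x).2⟩
    suffices br m n x y = -(psgn ((m * n : ℤ) : ZMod 2) • yx) from congrArg Subtype.val this
    refine hφ _ (Subtype.ext ?_)
    rw [map_neg, map_zsmul, gradedMap_cast φ (add_comm n m), hbr, hbr]
    exact h.skew m n _ _
  jacobi m n p x y z := by
    have hxyz : m + n + p = m + (n + p) := by ring
    have hyxz : n + (m + p) = m + (n + p) := by ring
    let xyz : L (m + (n + p)) := ⟨br (m + n) p (br m n x y) z, hxyz ▸ Subtype.prop _⟩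
    let yxz : L (m + (n + p)) := ⟨br n (m + p) y (br m p x z), hyxz ▸ Subtype.prop _⟩
    suffices br m (n + p) x (br n p y z) = xyz + psgn ((m * n : ℤ) : ZMod 2) • yxz from
      congrArg Subtype.val this
    refine hφ _ (Subtype.ext ?_)
    rw [map_add, map_zsmul, gradedMap_cast φ hxyz, gradedMap_cast φ hyxz]
    simp only [hbr]
    exact h.jacobi m n p _ _ _

theorem IsGradedLieHom.map_isMaurerCartan {φ : ∀ n : ℤ, L n →ₗ[K] L' n}
    (h : IsGradedLieHom L L' br br' φ) {x : L 1} (hx : IsMaurerCartan L br x) :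
    IsMaurerCartan L' br' (φ 1 x) := by
  rw [IsMaurerCartan] at hx ⊢
  rw [← h.map_bracket, hx, map_zero]

end GradedLie

section Shuffles

/-- The permutation that sends `j` to `0` and `j.succAbove p` to `(σ p).succ`: as a reordering of a
word, it applies `σ` to all letters but the first and puts the first letter in position `j`. -/
def insPerm {N : ℕ} (j : Fin (N + 1)) (σ : Equiv.Perm (Fin N)) : Equiv.Perm (Fin (N + 1)) :=
  ((finSuccEquiv' j).trans (Equiv.optionCongr σ)).trans (finSuccEquiv' 0).symm

@[simp]
theorem insPerm_self {N : ℕ} (j : Fin (N + 1)) (σ : Equiv.Perm (Fin N)) : insPerm j σ j = 0 := by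
  simp [insPerm]

@[simp]
theorem insPerm_succAbove {N : ℕ} (j : Fin (N + 1)) (σ : Equiv.Perm (Fin N)) (p : Fin N) :
    insPerm j σ (j.succAbove p) = (σ p).succ := by
  simp [insPerm]

@[simp]
theorem insPerm_zero_succ {N : ℕ} (σ : Equiv.Perm (Fin N)) (p : Fin N) :
    insPerm 0 σ p.succ = (σ p).succ := by
  simpa using insPerm_succAbove 0 σ p

theorem insPerm_bijective (N : ℕ) : Function.Bijective
    fun x : Fin (N + 1) × Equiv.Perm (Fin N) => insPerm x.1 x.2 := by
  rw [Fintype.bijective_iff_injective_and_card]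
  refine ⟨?_, by simp [Fintype.card_perm, Nat.factorial_succ]⟩
  rintro ⟨j, σ⟩ ⟨j', σ'⟩ h
  replace h : insPerm j σ = insPerm j' σ' := h
  obtain rfl : j = j' := (insPerm j' σ').injective (by rw [insPerm_self, ← h, insPerm_self])
  refine Prod.ext rfl (Equiv.ext fun p => Fin.succ_injective _ ?_)
  rw [← insPerm_succAbove j, h, insPerm_succAbove]

theorem sum_perm_succ {M : Type*} [AddCommMonoid M] {N : ℕ} (t : Equiv.Perm (Fin (N + 1)) → M) :
    ∑ σ, t σ = ∑ j, ∑ σ, t (insPerm j σ) := by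
  rw [← Fintype.sum_prod_type' fun j σ => t (insPerm j σ)]
  exact ((insPerm_bijective N).sum_comp t).symm

theorem succAbove_val {N : ℕ} (j : Fin (N + 1)) (p : Fin N) :
    (j.succAbove p : ℕ) = if (p : ℕ) < j then (p : ℕ) else p + 1 := by
  simp only [Fin.succAbove, Fin.lt_def, Fin.val_castSucc]
  split_ifs <;> simp

theorem insPerm_zero_mem_shuffles {c b N : ℕ} {σ : Equiv.Perm (Fin (N + 1))} :
    insPerm 0 σ ∈ shuffles (c + 1) b (N + 1) ↔ σ ∈ shuffles c b N := by
  simp only [shuffles, Finset.mem_filter, Finset.mem_univ, true_and, add_right_comm c 1 b,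
    Fin.forall_fin_succ (n := N + 1), insPerm_self, insPerm_zero_succ, Fin.val_succ,
    Fin.succ_lt_succ_iff, Fin.val_zero, Fin.succ_pos, Fin.not_lt_zero,
    Fin.succ_inj, Nat.add_lt_add_iff_right, Nat.add_le_add_iff_right,
    implies_true, false_imp_iff, true_and]

theorem insPerm_mk_mem_shuffles {c b N : ℕ} (hc : c < N + 2) {σ : Equiv.Perm (Fin (N + 1))} :
    insPerm ⟨c, hc⟩ σ ∈ shuffles c (b + 1) (N + 1) ↔ σ ∈ shuffles c b N := by
  have hlt (p : Fin (N + 1)) : (Fin.succAbove ⟨c, hc⟩ p : ℕ) < c ↔ (p : ℕ) < c := by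
    rw [succAbove_val]; grind
  have hle (p : Fin (N + 1)) : c ≤ (Fin.succAbove ⟨c, hc⟩ p : ℕ) ↔ c ≤ (p : ℕ) := by
    rw [succAbove_val]; grind
  have hlt' (p : Fin (N + 1)) : (Fin.succAbove ⟨c, hc⟩ p : ℕ) < c + (b + 1) ↔ (p : ℕ) < c + b := by
    rw [succAbove_val]; grind
  have hle' (p : Fin (N + 1)) : c + (b + 1) ≤ (Fin.succAbove ⟨c, hc⟩ p : ℕ) ↔ c + b ≤ (p : ℕ) := by
    rw [succAbove_val]; grind
  have hfix (p : Fin (N + 1)) (hp : c + b ≤ (p : ℕ)) :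
      (σ p).succ = Fin.succAbove ⟨c, hc⟩ p ↔ σ p = p := by
    rw [Fin.succAbove_of_le_castSucc _ _ (Fin.le_def.2 (Nat.le_of_add_right_le hp)), Fin.succ_inj]
  have hself (p : Fin (N + 1)) : Fin.succAbove ⟨c, hc⟩ p < ⟨c, hc⟩ ↔ (p : ℕ) < c := hlt p
  simp +contextual only [shuffles, Finset.mem_filter, Finset.mem_univ, true_and,
    Fin.forall_iff_succAbove (⟨c, hc⟩ : Fin (N + 2)), insPerm_self, insPerm_succAbove,
    Fin.succAbove_lt_succAbove_iff, Fin.succ_lt_succ_iff, hlt, hle, hlt', hle', hfix, hself,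
    lt_self_iff_false, Fin.succ_pos, Fin.not_lt_zero]
  grind

theorem eq_of_insPerm_mem_shuffles {c b N : ℕ} (h : 0 < c + b) {j : Fin (N + 2)}
    {σ : Equiv.Perm (Fin (N + 1))} (hσ : insPerm j σ ∈ shuffles c b (N + 1)) :
    (j = 0 ∧ 0 < c) ∨ ((j : ℕ) = c ∧ 0 < b) := by
  simp only [shuffles, Finset.mem_filter, Finset.mem_univ, true_and] at hσ
  obtain ⟨hfirst, hsecond, hfix⟩ := hσ
  rcases lt_or_ge (j : ℕ) c with hj | hj
  · refine Or.inl ⟨?_, by omega⟩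
    by_contra h0
    simpa using hfirst 0 j (Fin.pos_of_ne_zero h0) hj
  rcases lt_or_ge (j : ℕ) (c + b) with hj' | hj'
  · refine Or.inr ⟨?_, by omega⟩
    by_contra h0
    simpa using hsecond ⟨c, by omega⟩ j le_rfl (Fin.lt_def.2 (by simp; omega)) hj'
  · have hj0 := hfix j hj'
    rw [insPerm_self, Fin.ext_iff, Fin.val_zero] at hj0
    omega

theorem shuffles_zero_zero (N : ℕ) : shuffles 0 0 N = {1} := by
  ext σ
  simp [shuffles, Equiv.ext_iff]

theorem sum_shuffles_succ {M : Type*} [AddCommMonoid M] {c b N : ℕ} (hc : c < N + 2)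
    (h : 0 < c + b) (t : Equiv.Perm (Fin (N + 2)) → M) :
    ∑ σ ∈ shuffles c b (N + 1), t σ =
      (if 0 < c then ∑ σ ∈ shuffles (c - 1) b N, t (insPerm 0 σ) else 0) +
        if 0 < b then ∑ σ ∈ shuffles c (b - 1) N, t (insPerm ⟨c, hc⟩ σ) else 0 := by
  classical
  let u (j : Fin (N + 2)) : M := ∑ σ with insPerm j σ ∈ shuffles c b (N + 1), t (insPerm j σ)
  have hsum : ∑ σ ∈ shuffles c b (N + 1), t σ = ∑ j, u j := by
    rw [← Finset.univ_inter (shuffles c b (N + 1)), ← Finset.sum_ite_mem, sum_perm_succ]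
    exact Finset.sum_congr rfl fun j _ => (Finset.sum_filter _ _).symm
  have hu (j : Fin (N + 2)) (hj : ¬((j = 0 ∧ 0 < c) ∨ ((j : ℕ) = c ∧ 0 < b))) : u j = 0 :=
    Finset.sum_eq_zero fun σ hσ =>
      absurd (eq_of_insPerm_mem_shuffles h (Finset.mem_filter.1 hσ).2) hj
  have hu0 (hc0 : 0 < c) : u 0 = ∑ σ ∈ shuffles (c - 1) b N, t (insPerm 0 σ) := by
    obtain ⟨c, rfl⟩ := Nat.exists_eq_add_one.2 hc0
    simp [u, insPerm_zero_mem_shuffles]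
  have huc (hb0 : 0 < b) : u ⟨c, hc⟩ = ∑ σ ∈ shuffles c (b - 1) N, t (insPerm ⟨c, hc⟩ σ) := by
    obtain ⟨b, rfl⟩ := Nat.exists_eq_add_one.2 hb0
    simp [u, insPerm_mk_mem_shuffles]
  rw [hsum]
  rcases Nat.eq_zero_or_pos c with rfl | hc0
  · rw [if_neg (lt_irrefl 0), if_pos (by omega), zero_add, ← huc (by omega)]
    exact Fintype.sum_eq_single _ fun j hj => hu j fun h =>
      h.elim (fun h => lt_irrefl 0 h.2) fun h => hj (Fin.ext h.1)
  · rw [if_pos hc0, ← hu0 hc0, Fintype.sum_eq_add 0 ⟨c, hc⟩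
      (fun h0 => hc0.ne (congrArg Fin.val h0)) fun j hj => hu j fun h =>
        h.elim (fun h => hj.1 h.1) fun h => hj.2 (Fin.ext h.1)]
    congr 1
    split_ifs with hb0
    · exact huc hb0
    · exact hu _ (by simp [Fin.ext_iff, hc0.ne', hb0])

theorem koszulExp_one {N : ℕ} (d : Fin N → ZMod 2) : koszulExp 1 d = 0 :=
  Finset.sum_eq_zero fun p _ => Finset.sum_eq_zero fun q _ =>
    if_neg fun h : p < q ∧ q < p => lt_asymm h.1 h.2

theorem koszulExp_insPerm {N : ℕ} (j : Fin (N + 1)) (σ : Equiv.Perm (Fin N))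
    (d : Fin (N + 1) → ZMod 2) :
    koszulExp (insPerm j σ) d =
      d 0 * (∑ p : Fin N, if (p : ℕ) < j then d (σ p).succ else 0) +
        koszulExp σ fun i => d i.succ := by
  have h (p : Fin N) : j.succAbove p < j ↔ (p : ℕ) < j := by
    rw [Fin.succAbove_lt_iff_castSucc_lt, Fin.lt_def, Fin.val_castSucc]
  simp only [koszulExp, Fin.sum_univ_succAbove _ j, insPerm_self, insPerm_succAbove,
    lt_self_iff_false, Fin.not_lt_zero, and_false, if_false, Finset.sum_const_zero, zero_add,
    Fin.succ_pos, and_true, h, Fin.succAbove_lt_succAbove_iff, Fin.succ_lt_succ_iff,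
    Finset.sum_add_distrib, Finset.mul_sum, mul_ite, mul_zero]
  simp only [mul_comm]

/-- The exponent of the sign in front of the summand of `circAt` that belongs to the shuffle `σ`,
where `n` and `d i` are the parities of the inserted map and of the `i`-th argument. -/
def circExp {N : ℕ} (n : ZMod 2) (c : ℕ) (σ : Equiv.Perm (Fin N)) (d : Fin N → ZMod 2) : ZMod 2 :=
  koszulExp σ d + n * ∑ p : Fin N, if (p : ℕ) < c then d (σ p) else 0

theorem circExp_zero_one {N : ℕ} (n : ZMod 2) (d : Fin N → ZMod 2) : circExp n 0 1 d = 0 := by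
  simp [circExp, koszulExp_one]

theorem circExp_insPerm_zero {N : ℕ} (n : ZMod 2) (c : ℕ) (σ : Equiv.Perm (Fin N))
    (d : Fin (N + 1) → ZMod 2) :
    circExp n (c + 1) (insPerm 0 σ) d = n * d 0 + circExp n c σ fun i => d i.succ := by
  simp only [circExp, koszulExp_insPerm, Fin.sum_univ_succ, insPerm_self, insPerm_zero_succ,
    Fin.val_zero, Fin.val_succ, Nat.not_lt_zero, Nat.succ_pos, Nat.add_lt_add_iff_right, if_true,
    if_false, Finset.sum_const_zero]
  ring

theorem circExp_insPerm_mk {N : ℕ} (n : ZMod 2) {c : ℕ} (hc : c < N + 1) (σ : Equiv.Perm (Fin N))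
    (d : Fin (N + 1) → ZMod 2) :
    circExp n c (insPerm ⟨c, hc⟩ σ) d = circExp (n + d 0) c σ fun i => d i.succ := by
  have hlt (p : Fin N) : (Fin.succAbove ⟨c, hc⟩ p : ℕ) < c ↔ (p : ℕ) < c := by
    rw [succAbove_val]; grind
  simp only [circExp, koszulExp_insPerm, Fin.sum_univ_succAbove _ (⟨c, hc⟩ : Fin (N + 1)),
    insPerm_self, insPerm_succAbove, lt_self_iff_false, if_false, hlt]
  ring

end Shuffles

section Insertion

variable {K A : Type*} [Field K] [AddCommGroup A] [Module K A]

theorem insertAt_apply {a b c N : ℕ} (h : a + b = N) (hc : c ≤ a)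
    (F : MultilinearMap K (fun _ : Fin (a + 1) => A) A)
    (G : MultilinearMap K (fun _ : Fin (b + 1) => A) A) (w : Fin (N + 1) → A) :
    insertAt h hc F G w = F (insertArgs h hc G w) := rfl

theorem insertArgs_eq_update {a b c N : ℕ} (h : a + b = N) (hc : c ≤ a)
    (G : MultilinearMap K (fun _ : Fin (b + 1) => A) A) (w : Fin (N + 1) → A) :
    insertArgs h hc G w = Function.update (insertArgs (K := K) h hc 0 w) ⟨c, Nat.lt_succ_of_le hc⟩
      (G fun t => w ⟨c + t, by omega⟩) := by
  funext r
  simp only [insertArgs, Function.update_apply, Fin.ext_iff]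
  split_ifs <;> first | rfl | omega

theorem insertAt_add_right {a b c N : ℕ} (h : a + b = N) (hc : c ≤ a)
    (F : MultilinearMap K (fun _ : Fin (a + 1) => A) A)
    (G G' : MultilinearMap K (fun _ : Fin (b + 1) => A) A) :
    insertAt h hc F (G + G') = insertAt h hc F G + insertAt h hc F G' := by
  ext w
  simp only [add_apply, insertAt_apply, insertArgs_eq_update h hc (G + G'),
    insertArgs_eq_update h hc G, insertArgs_eq_update h hc G', MultilinearMap.map_update_add]

theorem insertAt_smul_right {a b c N : ℕ} (h : a + b = N) (hc : c ≤ a) (k : K)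
    (F : MultilinearMap K (fun _ : Fin (a + 1) => A) A)
    (G : MultilinearMap K (fun _ : Fin (b + 1) => A) A) :
    insertAt h hc F (k • G) = k • insertAt h hc F G := by
  ext w
  simp only [smul_apply, insertAt_apply, insertArgs_eq_update h hc (k • G),
    insertArgs_eq_update h hc G, MultilinearMap.map_update_smul]

theorem insertAt_zero_zero {N : ℕ} (h : N + 1 + 0 = N + 1)
    (F : MultilinearMap K (fun _ : Fin (N + 2) => A) A)
    (G : MultilinearMap K (fun _ : Fin 1 => A) A) (x : A) (w : Fin (N + 1) → A) :
    insertAt h (Nat.zero_le _) F G (Fin.cons x w : Fin (N + 2) → A) =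
      F.curryLeft (G fun _ => x) w := by
  rw [insertAt_apply, MultilinearMap.curryLeft_apply]
  congr 1
  funext r
  cases r using Fin.cases with
  | zero =>
    simp only [insertArgs, Fin.val_zero, lt_self_iff_false, if_false, if_true, Fin.cons_zero]
    congr 1
    funext t
    obtain rfl : t = 0 := Fin.fin_one_eq_zero t
    rfl
  | succ r => rfl

theorem insertAt_cons_insPerm_zero {a b c N : ℕ} (h : a + b = N) (hc : c ≤ a)
    (F : MultilinearMap K (fun _ : Fin (a + 2) => A) A)
    (G : MultilinearMap K (fun _ : Fin (b + 1) => A) A) (x : A) (w : Fin (N + 1) → A)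
    (σ : Equiv.Perm (Fin (N + 1))) :
    (insertAt (show a + 1 + b = N + 1 by omega) (Nat.add_le_add_right hc 1) F G
      fun i => (Fin.cons x w : Fin (N + 2) → A) (insPerm 0 σ i)) =
      insertAt h hc (F.curryLeft x) G fun i => w (σ i) := by
  rw [insertAt_apply, insertAt_apply, MultilinearMap.curryLeft_apply]
  congr 1
  have hw (k : ℕ) (hk : k + 1 < N + 2) : (Fin.cons x w : Fin (N + 2) → A)
      (insPerm 0 σ ⟨k + 1, hk⟩) = w (σ ⟨k, Nat.lt_of_succ_lt_succ hk⟩) := by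
    rw [← Fin.succ_mk, insPerm_zero_succ, Fin.cons_succ]
  funext r
  cases r using Fin.cases with
  | zero => simp [insertArgs]
  | succ r =>
    simp only [insertArgs, Fin.cons_succ, Fin.val_succ, Nat.add_lt_add_iff_right,
      Nat.add_right_cancel_iff, Nat.add_right_comm _ 1, hw]

theorem insertAt_cons_insPerm_mk {a b c N : ℕ} (h : a + b = N) (hc : c ≤ a)
    (F : MultilinearMap K (fun _ : Fin (a + 1) => A) A)
    (G : MultilinearMap K (fun _ : Fin (b + 2) => A) A) (x : A) (w : Fin (N + 1) → A)
    (σ : Equiv.Perm (Fin (N + 1))) :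
    (insertAt (show a + (b + 1) = N + 1 by omega) hc F G
      fun i => (Fin.cons x w : Fin (N + 2) → A) (insPerm ⟨c, by omega⟩ σ i)) =
      insertAt h hc F (G.curryLeft x) fun i => w (σ i) := by
  rw [insertAt_apply, insertAt_apply]
  congr 1
  have hlt (k : ℕ) (hk : k < N + 2) (hk' : k < c) : (Fin.cons x w : Fin (N + 2) → A)
      (insPerm ⟨c, by omega⟩ σ ⟨k, hk⟩) = w (σ ⟨k, by omega⟩) := by
    have : (⟨k, hk⟩ : Fin (N + 2)) = Fin.succAbove ⟨c, by omega⟩ ⟨k, by omega⟩ :=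
      Fin.ext (by rw [succAbove_val, if_pos hk'])
    rw [this, insPerm_succAbove, Fin.cons_succ]
  have hge (k : ℕ) (hk : k + 1 < N + 2) (hk' : c ≤ k) : (Fin.cons x w : Fin (N + 2) → A)
      (insPerm ⟨c, by omega⟩ σ ⟨k + 1, hk⟩) = w (σ ⟨k, by omega⟩) := by
    have : (⟨k + 1, hk⟩ : Fin (N + 2)) = Fin.succAbove ⟨c, by omega⟩ ⟨k, by omega⟩ :=
      Fin.ext (by rw [succAbove_val, if_neg (Nat.not_lt.2 hk')])
    rw [this, insPerm_succAbove, Fin.cons_succ]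
  funext r
  simp only [insertArgs]
  split_ifs with hr hr'
  · exact hlt _ _ hr
  · rw [MultilinearMap.curryLeft_apply]
    congr 1
    funext t
    cases t using Fin.cases with
    | zero => simp
    | succ t => exact hge (c + t) (by omega) (by omega)
  · exact hge (r + b) _ (by omega)

end Insertion

section Composition

variable {K A : Type*} [Field K] [AddCommGroup A] [Module K A]

/-- The contraction of a family by its first argument: the family `w ↦ f (x, w)`. -/
def contract : A →ₗ[K] Family K A →ₗ[K] Family K A :=
  LinearMap.mk₂ K (fun x f k => (f (k + 1)).curryLeft x)
    (fun x y f => funext fun k => map_add (f (k + 1)).curryLeft x y)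
    (fun c x f => funext fun k => map_smul (f (k + 1)).curryLeft c x)
    (fun _ _ _ => rfl) (fun _ _ _ => rfl)

/-- The component of arity one of a family, as a linear map. -/
def unary : Family K A →ₗ[K] A →ₗ[K] A where
  toFun f := (MultilinearMap.ofSubsingletonₗ K K A A (0 : Fin 1)).symm (f 0)
  map_add' f g := map_add (MultilinearMap.ofSubsingletonₗ K K A A (0 : Fin 1)).symm (f 0) (g 0)
  map_smul' c f := map_smul (MultilinearMap.ofSubsingletonₗ K K A A (0 : Fin 1)).symm c (f 0)

theorem contract_apply (x : A) (f : Family K A) (k : ℕ) (w : Fin (k + 1) → A) :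
    contract x f k w = f (k + 1) (Fin.cons x w) := rfl

theorem unary_apply (f : Family K A) (x : A) : unary f x = f 0 fun _ => x := rfl

theorem component_zero_ext {f g : Family K A} (h : unary f = unary g) : f 0 = g 0 :=
  (MultilinearMap.ofSubsingletonₗ K K A A (0 : Fin 1)).symm.injective h

variable (𝒜 : ℤ → Submodule K A) [DirectSum.Decomposition 𝒜]

theorem component_succ_ext {f g : Family K A} {N : ℕ}
    (h : ∀ i, ∀ x ∈ 𝒜 i, contract x f N = contract x g N) : f (N + 1) = g (N + 1) :=
  (multilinearCurryLeftEquiv K (fun _ : Fin (N + 2) => A) A).injective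
    (linearMap_ext_homogeneous 𝒜 h)

/-- The composition `circ` as a bilinear map. -/
def circBilin (n : ℤ) : Family K A →ₗ[K] Family K A →ₗ[K] Family K A :=
  LinearMap.mk₂ K (circ 𝒜 n)
    (fun f f' g => funext fun N => MultilinearMap.ext fun v => by
      simp only [circ, circAt, Pi.add_apply, sum_apply, add_apply, smul_apply, insertAt_apply,
        MultilinearMap.compLinearMap_apply, MultilinearMap.domDomCongr_apply, smul_add,
        Finset.sum_add_distrib])
    (fun k f g => funext fun N => MultilinearMap.ext fun v => by
      simp only [circ, circAt, Pi.smul_apply, sum_apply, smul_apply, insertAt_apply,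
        MultilinearMap.compLinearMap_apply, MultilinearMap.domDomCongr_apply, Finset.smul_sum,
        smul_comm k])
    (fun f g g' => funext fun N => MultilinearMap.ext fun v => by
      simp only [circ, circAt, Pi.add_apply, sum_apply, add_apply, smul_apply, insertAt_add_right,
        MultilinearMap.compLinearMap_apply, MultilinearMap.domDomCongr_apply, smul_add,
        Finset.sum_add_distrib])
    (fun k f g => funext fun N => MultilinearMap.ext fun v => by
      simp only [circ, circAt, Pi.smul_apply, sum_apply, smul_apply, insertAt_smul_right,
        MultilinearMap.compLinearMap_apply, MultilinearMap.domDomCongr_apply, Finset.smul_sum,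
        smul_comm k])

theorem circAt_apply_homogeneous (n : ℤ) {a b c N : ℕ} (h : a + b = N) (hc : c ≤ a)
    (F : MultilinearMap K (fun _ : Fin (a + 1) => A) A)
    (G : MultilinearMap K (fun _ : Fin (b + 1) => A) A)
    {d : Fin (N + 1) → ℤ} {v : Fin (N + 1) → A} (hv : ∀ j, v j ∈ 𝒜 (d j)) :
    circAt 𝒜 n h hc F G v = ∑ σ ∈ shuffles c b N,
      psgn (circExp n c σ fun j => d j) • insertAt h hc F G fun j => v (σ j) :=
  circAt_apply 𝒜 n h hc F G d v hv

theorem sum_insPerm_zero_eq_circAt (n : ℤ) {a b c N : ℕ} (h : a + b = N) (hc : c ≤ a)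
    (F : MultilinearMap K (fun _ : Fin (a + 2) => A) A)
    (G : MultilinearMap K (fun _ : Fin (b + 1) => A) A) (i : ℤ) (x : A)
    {d : Fin (N + 1) → ℤ} {w : Fin (N + 1) → A} (hw : ∀ j, w j ∈ 𝒜 (d j)) :
    ∑ σ ∈ shuffles c b N,
        psgn (circExp n (c + 1) (insPerm 0 σ) fun j => (Fin.cons i d : Fin (N + 2) → ℤ) j) •
          insertAt (show a + 1 + b = N + 1 by omega) (Nat.add_le_add_right hc 1) F G
            (fun j => (Fin.cons x w : Fin (N + 2) → A) (insPerm 0 σ j)) =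
      psgn (n * i : ℤ) • circAt 𝒜 n h hc (F.curryLeft x) G w := by
  simp only [circAt_apply_homogeneous 𝒜 n h hc _ G hw, insertAt_cons_insPerm_zero h hc,
    circExp_insPerm_zero, psgn_add, mul_smul, Finset.smul_sum, Fin.cons_zero, Fin.cons_succ,
    Int.cast_mul]

theorem sum_insPerm_mk_eq_circAt (n : ℤ) {a b c N : ℕ} (h : a + b = N) (hc : c ≤ a)
    (F : MultilinearMap K (fun _ : Fin (a + 1) => A) A)
    (G : MultilinearMap K (fun _ : Fin (b + 2) => A) A) (i : ℤ) (x : A)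
    {d : Fin (N + 1) → ℤ} {w : Fin (N + 1) → A} (hw : ∀ j, w j ∈ 𝒜 (d j)) :
    ∑ σ ∈ shuffles c b N,
        psgn (circExp n c (insPerm ⟨c, by omega⟩ σ)
            fun j => (Fin.cons i d : Fin (N + 2) → ℤ) j) •
          insertAt (show a + (b + 1) = N + 1 by omega) hc F G
            (fun j => (Fin.cons x w : Fin (N + 2) → A) (insPerm ⟨c, by omega⟩ σ j)) =
      circAt 𝒜 (n + i) h hc F (G.curryLeft x) w := by
  simp only [circAt_apply_homogeneous 𝒜 (n + i) h hc F _ hw, insertAt_cons_insPerm_mk h hc,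
    circExp_insPerm_mk, Fin.cons_zero, Fin.cons_succ, Int.cast_add]

/-- The summand of `circ` for given arities `a + 1`, `b + 1` and a given position `c` of the
insertion, extended by `0` to all natural numbers. -/
def circTerm (n : ℤ) (f g : Family K A) (N a b c : ℕ) :
    MultilinearMap K (fun _ : Fin (N + 1) => A) A :=
  if h : a + b = N ∧ c ≤ a then circAt 𝒜 n h.1 h.2 (f a) (g b) else 0

theorem circTerm_of_le (n : ℤ) (f g : Family K A) {N a b c : ℕ} (h : a + b = N) (hc : c ≤ a) :
    circTerm 𝒜 n f g N a b c = circAt 𝒜 n h hc (f a) (g b) :=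
  dif_pos ⟨h, hc⟩

theorem circBilin_eq_sum (n : ℤ) (f g : Family K A) (N : ℕ) :
    circBilin 𝒜 n f g N = ∑ p ∈ Finset.HasAntidiagonal.antidiagonal N,
      ∑ c ∈ Finset.range (p.1 + 1), circTerm 𝒜 n f g N p.1 p.2 c := by
  change circ 𝒜 n f g N = _
  rw [circ, ← Finset.sum_attach (Finset.HasAntidiagonal.antidiagonal N)]
  refine Finset.sum_congr rfl fun p _ => ?_
  rw [← Fin.sum_univ_eq_sum_range]
  exact Finset.sum_congr rfl fun c _ => (circTerm_of_le 𝒜 n f g _ _).symm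

theorem circTerm_cons (n : ℤ) (f g : Family K A) {N a b c : ℕ} (h : a + b = N + 1) (hc : c ≤ a)
    {i : ℤ} {x : A} (hx : x ∈ 𝒜 i) {d : Fin (N + 1) → ℤ} {w : Fin (N + 1) → A}
    (hw : ∀ j, w j ∈ 𝒜 (d j)) :
    circTerm 𝒜 n f g (N + 1) a b c (Fin.cons x w : Fin (N + 2) → A) =
      (if 0 < c then psgn (n * i : ℤ) • circTerm 𝒜 n (contract x f) g N (a - 1) b (c - 1) w
        else 0) +
      (if 0 < b then circTerm 𝒜 (n + i) f (contract x g) N a (b - 1) c w else 0) +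
      (if c = 0 ∧ b = 0 then contract (unary g x) f N w else 0) := by
  have hv : ∀ j, (Fin.cons x w : Fin (N + 2) → A) j ∈ 𝒜 ((Fin.cons i d : Fin (N + 2) → ℤ) j) :=
    Fin.cases hx hw
  rw [circTerm_of_le 𝒜 n f g h hc, circAt_apply_homogeneous 𝒜 n h hc _ _ hv]
  rcases Nat.eq_zero_or_pos (c + b) with h0 | h0
  · obtain ⟨rfl, rfl⟩ : c = 0 ∧ b = 0 := by omega
    obtain rfl : a = N + 1 := h
    rw [shuffles_zero_zero, Finset.sum_singleton, circExp_zero_one, if_neg (lt_irrefl 0),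
      if_neg (lt_irrefl 0), if_pos ⟨rfl, rfl⟩, zero_add, zero_add]
    exact (one_smul ℤ _).trans (insertAt_zero_zero rfl (f (N + 1)) (g 0) x w)
  rw [sum_shuffles_succ (show c < N + 2 by omega) h0, if_neg (show ¬(c = 0 ∧ b = 0) by omega),
    add_zero]
  congr 1
  · split_ifs with hc0
    · obtain ⟨c, rfl⟩ := Nat.exists_eq_add_one.2 hc0
      obtain ⟨a, rfl⟩ := Nat.exists_eq_add_one.2 (hc0.trans_le hc)
      have h' : a + b = N := by omega
      have hc' : c ≤ a := Nat.le_of_succ_le_succ hc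
      rw [Nat.add_sub_cancel, Nat.add_sub_cancel, circTerm_of_le 𝒜 n _ g h' hc']
      exact sum_insPerm_zero_eq_circAt 𝒜 n h' hc' (f (a + 1)) (g b) i x hw
    · rfl
  · split_ifs with hb0
    · obtain ⟨b, rfl⟩ := Nat.exists_eq_add_one.2 hb0
      have h' : a + b = N := by omega
      rw [Nat.add_sub_cancel, circTerm_of_le 𝒜 (n + i) f _ h' hc]
      exact sum_insPerm_mk_eq_circAt 𝒜 n h' hc (f a) (g (b + 1)) i x hw
    · rfl

theorem sum_antidiagonal_range_pred {M : Type*} [AddCommMonoid M] (N : ℕ) (t : ℕ → ℕ → ℕ → M) :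
    (∑ p ∈ Finset.HasAntidiagonal.antidiagonal (N + 1), ∑ c ∈ Finset.range (p.1 + 1),
      if 0 < c then t (p.1 - 1) p.2 (c - 1) else 0) =
      ∑ p ∈ Finset.HasAntidiagonal.antidiagonal N, ∑ c ∈ Finset.range (p.1 + 1), t p.1 p.2 c := by
  simp [Finset.Nat.sum_antidiagonal_succ, Finset.sum_range_succ' _ (_ + 1)]

theorem sum_antidiagonal_snd_pred {M : Type*} [AddCommMonoid M] (N : ℕ) (t : ℕ → ℕ → ℕ → M) :
    (∑ p ∈ Finset.HasAntidiagonal.antidiagonal (N + 1), ∑ c ∈ Finset.range (p.1 + 1),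
      if 0 < p.2 then t p.1 (p.2 - 1) c else 0) =
      ∑ p ∈ Finset.HasAntidiagonal.antidiagonal N, ∑ c ∈ Finset.range (p.1 + 1), t p.1 p.2 c := by
  simp [Finset.Nat.sum_antidiagonal_succ']

theorem sum_antidiagonal_ite_zero {M : Type*} [AddCommMonoid M] (N : ℕ) (z : M) :
    (∑ p ∈ Finset.HasAntidiagonal.antidiagonal N, ∑ c ∈ Finset.range (p.1 + 1),
      if c = 0 ∧ p.2 = 0 then z else 0) = z := by
  cases N <;> simp [Finset.Nat.sum_antidiagonal_succ']

theorem unary_circBilin (n : ℤ) (f g : Family K A) :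
    unary (circBilin 𝒜 n f g) = unary f ∘ₗ unary g := by
  refine linearMap_ext_homogeneous 𝒜 fun i x hx => ?_
  rw [unary_apply, circBilin_eq_sum]
  simp only [Finset.Nat.antidiagonal_zero, Finset.sum_singleton, zero_add, Finset.sum_range_one]
  rw [circTerm_of_le 𝒜 n f g (zero_add 0) le_rfl,
    circAt_apply_homogeneous 𝒜 n (zero_add 0) le_rfl _ _ fun _ => hx, shuffles_zero_zero,
    Finset.sum_singleton, circExp_zero_one, show psgn 0 = 1 from rfl, one_smul, insertAt_apply,
    LinearMap.comp_apply, unary_apply]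
  congr 1
  funext r
  simp [insertArgs, unary_apply]

/-- The three terms: `x` is the only argument of `g`, the first argument of `f`, or the first
of several arguments of `g`. -/
theorem contract_circBilin (n : ℤ) (f g : Family K A) {i : ℤ} {x : A} (hx : x ∈ 𝒜 i) :
    contract x (circBilin 𝒜 n f g) =
      contract (unary g x) f + psgn (n * i : ℤ) • circBilin 𝒜 n (contract x f) g +
        circBilin 𝒜 (n + i) f (contract x g) := by
  funext N
  refine multilinearMap_ext_homogeneous 𝒜 fun d w hw => ?_
  have hcons := Finset.sum_congr rfl fun p hp => Finset.sum_congr rfl fun c hc =>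
    circTerm_cons 𝒜 n f g (Finset.HasAntidiagonal.mem_antidiagonal.1 hp)
      (Nat.lt_succ_iff.1 (Finset.mem_range.1 hc)) hx hw
  simp only [Finset.sum_add_distrib,
    sum_antidiagonal_range_pred N fun a b c =>
      psgn (n * i : ℤ) • circTerm 𝒜 n (contract x f) g N a b c w,
    sum_antidiagonal_snd_pred N fun a b c => circTerm 𝒜 (n + i) f (contract x g) N a b c w,
    sum_antidiagonal_ite_zero] at hcons
  simp only [contract_apply x (circBilin 𝒜 n f g), circBilin_eq_sum, Pi.add_apply, Pi.smul_apply,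
    add_apply, smul_apply, sum_apply, hcons, Finset.smul_sum]
  abel

end Composition

section PreLie

variable {K A : Type*} [Field K] [AddCommGroup A] [Module K A]

theorem contract_mem {𝒜 : ℤ → Submodule K A} {m i : ℤ} {f : Family K A} (hf : f ∈ CL 𝒜 m)
    {x : A} (hx : x ∈ 𝒜 i) : contract x f ∈ CL 𝒜 (m + i) := by
  intro a d v hv
  have hfx := hf (a + 1) (Fin.cons i d) (Fin.cons x v) (Fin.cases hx hv)
  rwa [Fin.sum_cons, show i + ∑ j, d j + m = ∑ j, d j + (m + i) by ring] at hfx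

theorem unary_mem {𝒜 : ℤ → Submodule K A} {m i : ℤ} {f : Family K A} (hf : f ∈ CL 𝒜 m)
    {x : A} (hx : x ∈ 𝒜 i) : unary f x ∈ 𝒜 (i + m) := by
  simpa [unary_apply] using hf 0 (fun _ => i) (fun _ => x) fun _ => hx

variable (𝒜 : ℤ → Submodule K A) [DirectSum.Decomposition 𝒜]

theorem unary_gradedAssociator (n p : ℤ) (f g h : Family K A) :
    unary (gradedAssociator (circBilin 𝒜) n p f g h) = 0 := by
  simp only [gradedAssociator, map_sub, unary_circBilin, LinearMap.comp_assoc, sub_self]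

theorem contract_gradedAssociator (n : ℤ) {p : ℤ} (f g : Family K A) {h : Family K A}
    (hh : h ∈ CL 𝒜 p) {i : ℤ} {x : A} (hx : x ∈ 𝒜 i) :
    contract x (gradedAssociator (circBilin 𝒜) n p f g h) =
      psgn (n * (i + p) : ℤ) • circBilin 𝒜 n (contract (unary h x) f) g +
      psgn (p * i : ℤ) • circBilin 𝒜 p (contract (unary g x) f) h +
      psgn ((n + p) * i : ℤ) • gradedAssociator (circBilin 𝒜) n p (contract x f) g h +
      psgn (p * i : ℤ) • gradedAssociator (circBilin 𝒜) (n + i) p f (contract x g) h +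
      gradedAssociator (circBilin 𝒜) n (p + i) f g (contract x h) := by
  have hsign : psgn ((n + p) * i : ℤ) = psgn (n * i : ℤ) * psgn (p * i : ℤ) := by
    rw [← psgn_add, add_mul, Int.cast_add]
  simp only [gradedAssociator, map_sub, map_add, map_zsmul, contract_circBilin 𝒜 _ _ _ hx,
    contract_circBilin 𝒜 _ _ _ (unary_mem hh hx), unary_circBilin, LinearMap.add_apply,
    LinearMap.smul_apply, LinearMap.comp_apply, add_right_comm n i p, ← add_assoc n p i,
    add_comm i p, hsign]
  module

theorem gradedAssociator_circBilin_comm {n p : ℤ} (f : Family K A) {g h : Family K A}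
    (hg : g ∈ CL 𝒜 n) (hh : h ∈ CL 𝒜 p) :
    gradedAssociator (circBilin 𝒜) n p f g h =
      psgn (n * p : ℤ) • gradedAssociator (circBilin 𝒜) p n f h g := by
  funext N
  induction N generalizing n p f g h with
  | zero =>
    refine component_zero_ext ?_
    rw [map_zsmul, unary_gradedAssociator, unary_gradedAssociator, smul_zero]
  | succ N ih =>
    refine component_succ_ext 𝒜 fun i x hx => ?_
    rw [map_zsmul, contract_gradedAssociator 𝒜 n f g hh hx,
      contract_gradedAssociator 𝒜 p f h hg hx]
    simp only [Pi.add_apply, Pi.smul_apply, ih (contract x f) hg hh,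
      ih f (contract_mem hg hx) hh, ih f hg (contract_mem hh hx)]
    push_cast
    simp only [mul_add, add_mul, psgn_add, mul_comm (i : ZMod 2), mul_comm (p : ZMod 2) n]
    rcases psgn_eq_one_or_neg_one (n * p) with h1 | h1 <;>
    rcases psgn_eq_one_or_neg_one (n * i) with h2 | h2 <;>
    rcases psgn_eq_one_or_neg_one (p * i) with h3 | h3 <;> rw [h1, h2, h3] <;> module

theorem circBilin_isGradedPreLie : IsGradedPreLie (CL 𝒜) (circBilin 𝒜) :=
  fun _ _ _ f g h => gradedAssociator_circBilin_comm 𝒜 (f : Family K A) g.2 h.2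

theorem balavoine_isGradedLieAlgebra : IsGradedLieAlgebra (CL 𝒜) (balavoineBracket 𝒜) :=
  (circBilin_isGradedPreLie 𝒜).isGradedLieAlgebra fun _ _ _ _ => rfl

theorem contract_gradedCommutator (m n : ℤ) (f g : Family K A) {i : ℤ} {x : A} (hx : x ∈ 𝒜 i) :
    contract x (gradedCommutator (circBilin 𝒜) m n f g) =
      contract (unary g x) f - psgn ((m * n : ℤ) : ZMod 2) • contract (unary f x) g +
        psgn (n * i : ℤ) • gradedCommutator (circBilin 𝒜) (m + i) n (contract x f) g +
        gradedCommutator (circBilin 𝒜) m (n + i) f (contract x g) := by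
  simp only [gradedCommutator, map_sub, map_zsmul, contract_circBilin 𝒜 _ _ _ hx]
  push_cast
  simp only [mul_add, add_mul, psgn_add, mul_comm (i : ZMod 2)]
  rcases psgn_eq_one_or_neg_one (m * n) with hmn | hmn <;>
  rcases psgn_eq_one_or_neg_one (m * i) with hmi | hmi <;>
  rcases psgn_eq_one_or_neg_one (n * i) with hni | hni <;> rw [hmn, hmi, hni] <;> module

end PreLie

section TensorProduct

variable {K V W : Type*} [Field K] [AddCommGroup V] [Module K V] [AddCommGroup W] [Module K W]

theorem mem_span_singleton_of_tmul_eq_tmul {u x : V} {v w : W} (hv : v ≠ 0)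
    (h : u ⊗ₜ[K] v = x ⊗ₜ[K] w) : u ∈ Submodule.span K {x} := by
  obtain ⟨φ, hφ⟩ := Module.Projective.exists_dual_eq_one K hv
  have hu := congrArg ((TensorProduct.rid K V).toLinearMap ∘ₗ LinearMap.lTensor V φ) h
  simp only [LinearMap.comp_apply, LinearMap.lTensor_tmul, LinearEquiv.coe_coe,
    TensorProduct.rid_tmul, hφ, one_smul] at hu
  exact hu ▸ Submodule.smul_mem _ _ (Submodule.mem_span_singleton_self x)

theorem tmul_ne_zero {x : V} {y : W} (hx : x ≠ 0) (hy : y ≠ 0) : x ⊗ₜ[K] y ≠ 0 := fun h =>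
  hx <| by
    simpa using mem_span_singleton_of_tmul_eq_tmul (x := (0 : V)) hy
      (h.trans (TensorProduct.zero_tmul V y).symm)

end TensorProduct

section Derivations

variable {K V : Type*} [Field K] [AddCommGroup V] [Module K V] (𝒱 : ℤ → Submodule K V)

/-- The homogeneous endomorphisms of degree `t`. -/
def homDeg (t : ℤ) : Submodule K (V →ₗ[K] V) where
  carrier := {T | ∀ i, ∀ x ∈ 𝒱 i, T x ∈ 𝒱 (i + t)}
  zero_mem' := fun _ _ _ => zero_mem _
  add_mem' := fun hT hS i x hx => add_mem (hT i x hx) (hS i x hx)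
  smul_mem' := fun c _ hT i x hx => Submodule.smul_mem _ c (hT i x hx)

variable {𝒱} in
theorem comp_mem_homDeg {m n : ℤ} {S T : V →ₗ[K] V} (hS : S ∈ homDeg 𝒱 m)
    (hT : T ∈ homDeg 𝒱 n) : S ∘ₗ T ∈ homDeg 𝒱 (m + n) := fun i x hx => by
  have hST := hS _ _ (hT i x hx)
  rwa [add_assoc, add_comm n m] at hST

variable [DirectSum.Decomposition 𝒱]

/-- The endomorphisms that shift parities by `q`. Signs only depend on parities, so these are
the endomorphisms for which the extension to a derivation makes sense. -/
def homParity (q : ZMod 2) : Submodule K (V →ₗ[K] V) where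
  carrier := {T | ∀ i : ℤ, ∀ x ∈ 𝒱 i, parityProj 𝒱 (i + q) (T x) = T x}
  zero_mem' := fun _ _ _ => map_zero _
  add_mem' := fun hT hS i x hx => by rw [LinearMap.add_apply, map_add, hT i x hx, hS i x hx]
  smul_mem' := fun c _ hT i x hx => by rw [LinearMap.smul_apply, map_smul, hT i x hx]

theorem homDeg_le_homParity (t : ℤ) : homDeg 𝒱 t ≤ homParity 𝒱 t := fun T hT i x hx => by
  rw [parityProj_apply 𝒱 _ (hT i x hx), if_pos (Int.cast_add i t)]

/-- The extension of an endomorphism `T` of parity `q` to a derivation of the tensor square: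
`x ⊗ y ↦ T x ⊗ y + (-1)^(|x| q) x ⊗ T y`. -/
def derExt (q : ZMod 2) : (V →ₗ[K] V) →ₗ[K] (V ⊗[K] V →ₗ[K] V ⊗[K] V) :=
  LinearMap.rTensorHom V + TensorProduct.mapBilinear (RingHom.id K) V V V V (parityTwist 𝒱 q)

theorem derExt_tmul (q : ZMod 2) (T : V →ₗ[K] V) {i : ℤ} {x : V} (hx : x ∈ 𝒱 i) (y : V) :
    derExt 𝒱 q T (x ⊗ₜ[K] y) = T x ⊗ₜ[K] y + psgn (i * q) • (x ⊗ₜ[K] T y) := by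
  simp only [derExt, LinearMap.add_apply, LinearMap.coe_rTensorHom, LinearMap.rTensor_tmul,
    TensorProduct.mapBilinear_apply, TensorProduct.map_tmul, parityTwist_apply 𝒱 _ hx,
    TensorProduct.smul_tmul', mul_comm q]

variable {𝒱} in
theorem eq_zero_of_derExt_eq_zero (h2 : (2 : K) ≠ 0) {q : ZMod 2} {T : V →ₗ[K] V}
    (hT : T ∈ homParity 𝒱 q) (h : derExt 𝒱 q T = 0) : T = 0 := by
  refine linearMap_ext_homogeneous 𝒱 fun i x hx => ?_
  rw [LinearMap.zero_apply]
  by_contra hTx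
  have hx0 : x ≠ 0 := fun hx0 => hTx (by rw [hx0, map_zero])
  have hxx : T x ⊗ₜ[K] x + psgn (i * q) • (x ⊗ₜ[K] T x) = 0 := by
    rw [← derExt_tmul 𝒱 q T hx, h, LinearMap.zero_apply]
  obtain ⟨c, hc⟩ : ∃ c : K, c • x = T x := by
    refine Submodule.mem_span_singleton.1
      (mem_span_singleton_of_tmul_eq_tmul (w := -(psgn (i * q) • T x)) hx0 ?_)
    rw [TensorProduct.tmul_neg, TensorProduct.tmul_smul, eq_neg_of_add_eq_zero_left hxx]
  have hq : q = 0 := by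
    have hp := hT i x hx
    rw [← hc, map_smul, parityProj_apply 𝒱 _ hx, hc] at hp
    by_contra hq
    rw [if_neg (by simpa using hq), smul_zero] at hp
    exact hTx hp.symm
  have h2xx : ((2 : K) * c) • (x ⊗ₜ[K] x) = 0 := by
    rw [← hc, hq, mul_zero, show psgn 0 = 1 from rfl, one_smul, TensorProduct.tmul_smul,
      ← TensorProduct.smul_tmul'] at hxx
    rw [two_mul, add_smul, hxx]
  rcases mul_eq_zero.1 ((smul_eq_zero.1 h2xx).resolve_right (tmul_ne_zero hx0 hx0)) with h0 | h0
  · exact h2 h0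
  · exact hTx (by rw [← hc, h0, zero_smul])

/-- A linear map that recovers an endomorphism of parity `q` from its extension to a derivation,
see `derInv_derExt`. -/
def derInv (q : ZMod 2) : (V ⊗[K] V →ₗ[K] V ⊗[K] V) →ₗ[K] (V →ₗ[K] V) :=
  (homParity 𝒱 q).subtype ∘ₗ (derExt 𝒱 q ∘ₗ (homParity 𝒱 q).subtype).leftInverse

variable {𝒱} in
theorem derInv_derExt (h2 : (2 : K) ≠ 0) {q : ZMod 2} {T : V →ₗ[K] V}
    (hT : T ∈ homParity 𝒱 q) : derInv 𝒱 q (derExt 𝒱 q T) = T :=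
  congrArg Subtype.val <| LinearMap.leftInverse_apply_of_inj
    (f := derExt 𝒱 q ∘ₗ (homParity 𝒱 q).subtype)
    (LinearMap.ker_eq_bot'.2 fun S hS => Subtype.ext (eq_zero_of_derExt_eq_zero h2 S.2 hS)) ⟨T, hT⟩

/-- The derivations of degree `t` of the tensor square that extend endomorphisms. -/
def derivations (t : ℤ) : Submodule K (V ⊗[K] V →ₗ[K] V ⊗[K] V) :=
  (homDeg 𝒱 t).map (derExt 𝒱 t)

variable {𝒱}

theorem derInv_mem_homDeg (h2 : (2 : K) ≠ 0) {t : ℤ} {φ : V ⊗[K] V →ₗ[K] V ⊗[K] V}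
    (hφ : φ ∈ derivations 𝒱 t) : derInv 𝒱 t φ ∈ homDeg 𝒱 t := by
  obtain ⟨T, hT, rfl⟩ := hφ
  rwa [derInv_derExt h2 (homDeg_le_homParity 𝒱 t hT)]

theorem derExt_derInv (h2 : (2 : K) ≠ 0) {t : ℤ} {φ : V ⊗[K] V →ₗ[K] V ⊗[K] V}
    (hφ : φ ∈ derivations 𝒱 t) : derExt 𝒱 t (derInv 𝒱 t φ) = φ := by
  obtain ⟨T, hT, rfl⟩ := hφ
  rw [derInv_derExt h2 (homDeg_le_homParity 𝒱 t hT)]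

theorem derExt_commutator {m n : ℤ} {S T : V →ₗ[K] V} (hS : S ∈ homDeg 𝒱 m)
    (hT : T ∈ homDeg 𝒱 n) :
    derExt 𝒱 (m + n : ℤ) (S ∘ₗ T - psgn ((m * n : ℤ) : ZMod 2) • T ∘ₗ S) =
      derExt 𝒱 m S ∘ₗ derExt 𝒱 n T -
        psgn ((m * n : ℤ) : ZMod 2) • derExt 𝒱 n T ∘ₗ derExt 𝒱 m S := by
  refine tensor_ext_homogeneous 𝒱 fun i x hx y => ?_
  simp only [LinearMap.sub_apply, LinearMap.smul_apply, LinearMap.comp_apply,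
    derExt_tmul 𝒱 _ _ hx, map_add, map_zsmul, derExt_tmul 𝒱 _ _ (hT i x hx),
    derExt_tmul 𝒱 _ _ (hS i x hx), TensorProduct.sub_tmul, TensorProduct.tmul_sub]
  push_cast
  simp only [mul_add, add_mul, psgn_add, mul_comm (n : ZMod 2) m, ← TensorProduct.smul_tmul',
    TensorProduct.tmul_smul]
  rcases psgn_eq_one_or_neg_one (m * n) with hmn | hmn <;>
  rcases psgn_eq_one_or_neg_one (i * m) with him | him <;>
  rcases psgn_eq_one_or_neg_one (i * n) with hin | hin <;> rw [hmn, him, hin] <;> module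

theorem commutator_mem_derivations {m n : ℤ} {φ ψ : V ⊗[K] V →ₗ[K] V ⊗[K] V}
    (hφ : φ ∈ derivations 𝒱 m) (hψ : ψ ∈ derivations 𝒱 n) :
    φ ∘ₗ ψ - psgn ((m * n : ℤ) : ZMod 2) • ψ ∘ₗ φ ∈ derivations 𝒱 (m + n) := by
  obtain ⟨S, hS, rfl⟩ := hφ
  obtain ⟨T, hT, rfl⟩ := hψ
  rw [← derExt_commutator hS hT]
  exact Submodule.mem_map_of_mem <| sub_mem (comp_mem_homDeg hS hT)
    (zsmul_mem (add_comm n m ▸ comp_mem_homDeg hT hS) _)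

end Derivations

section DerivationFamilies

variable {K V : Type*} [Field K] [AddCommGroup V] [Module K V]
  {𝒱 : ℤ → Submodule K V} [DirectSum.Decomposition 𝒱]

variable (𝒱) in
/-- The families whose component of arity `N + 1` is, as a function of its last argument, a
derivation of the tensor square. The degrees are those of a map of degree `n` on the suspension,
which lowers the degree of each of the `N` remaining arguments by one. -/
def derivationFamilies (n : ℤ) (N : ℕ) : Submodule K (Family K (V ⊗[K] V)) where
  carrier := {f | ∀ (d : Fin N → ℤ) (X : Fin N → V ⊗[K] V),
    (∀ i, X i ∈ tensorGrading 𝒱 (d i)) →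
      (f N).curryRight X ∈ derivations 𝒱 ((∑ i, d i) + n + N)}
  zero_mem' := fun _ _ _ => zero_mem _
  add_mem' := fun hf hg d X hX => add_mem (hf d X hX) (hg d X hX)
  smul_mem' := fun c _ hf d X hX => Submodule.smul_mem _ c (hf d X hX)

theorem curryRight_zero_eq_unary (f : Family K V) (X : Fin 0 → V) :
    (f 0).curryRight X = unary f := by
  refine LinearMap.ext fun z => ?_
  rw [MultilinearMap.curryRight_apply, unary_apply]
  congr 1

theorem curryRight_cons_eq_contract (f : Family K V) {N : ℕ} (x : V) (X : Fin N → V) :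
    (f (N + 1)).curryRight (Fin.cons x X) = (contract x f N).curryRight X := by
  refine LinearMap.ext fun z => ?_
  rw [MultilinearMap.curryRight_apply, MultilinearMap.curryRight_apply, contract_apply,
    Fin.cons_snoc_eq_snoc_cons]

theorem mem_derivationFamilies_zero {n : ℤ} {f : Family K (V ⊗[K] V)} :
    f ∈ derivationFamilies 𝒱 n 0 ↔ unary f ∈ derivations 𝒱 n := by
  constructor
  · intro hf
    simpa [curryRight_zero_eq_unary] using hf 0 0 fun i => i.elim0
  · intro hf d X _
    simpa [curryRight_zero_eq_unary] using hf

theorem mem_derivationFamilies_succ {n : ℤ} {N : ℕ} {f : Family K (V ⊗[K] V)} :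
    f ∈ derivationFamilies 𝒱 n (N + 1) ↔ ∀ i, ∀ x ∈ shift (tensorGrading 𝒱) i,
      contract x f ∈ derivationFamilies 𝒱 (n + i) N := by
  constructor
  · intro hf i x hx d X hX
    have hfx := hf (Fin.cons (i - 1) d) (Fin.cons x X) (Fin.cases hx hX)
    rw [curryRight_cons_eq_contract, Fin.sum_cons] at hfx
    convert hfx using 2
    push_cast
    ring
  · intro hf d X hX
    have hx : X 0 ∈ shift (tensorGrading 𝒱) (d 0 + 1) := by simpa [shift] using hX 0
    have hfx := hf _ _ hx (Fin.tail d) (Fin.tail X) fun j => hX j.succ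
    rw [← curryRight_cons_eq_contract, Fin.cons_self_tail] at hfx
    convert hfx using 2
    rw [Fin.sum_univ_succ]
    simp only [Fin.tail]
    push_cast
    ring

theorem gradedCommutator_mem_derivationFamilies {m n : ℤ} {f g : Family K (V ⊗[K] V)}
    (hf : f ∈ CL (shift (tensorGrading 𝒱)) m) (hg : g ∈ CL (shift (tensorGrading 𝒱)) n)
    (hf' : ∀ N, f ∈ derivationFamilies 𝒱 m N) (hg' : ∀ N, g ∈ derivationFamilies 𝒱 n N) (N : ℕ) :
    gradedCommutator (circBilin (shift (tensorGrading 𝒱))) m n f g ∈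
      derivationFamilies 𝒱 (m + n) N := by
  induction N generalizing m n f g with
  | zero =>
    rw [mem_derivationFamilies_zero, gradedCommutator, map_sub, map_zsmul, unary_circBilin,
      unary_circBilin]
    exact commutator_mem_derivations (mem_derivationFamilies_zero.1 (hf' 0))
      (mem_derivationFamilies_zero.1 (hg' 0))
  | succ N ih =>
    refine mem_derivationFamilies_succ.2 fun i x hx => ?_
    have hfx {j y} (hy : y ∈ shift (tensorGrading 𝒱) j) (N : ℕ) :
        contract y f ∈ derivationFamilies 𝒱 (m + j) N :=
      mem_derivationFamilies_succ.1 (hf' (N + 1)) j y hy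
    have hgx {j y} (hy : y ∈ shift (tensorGrading 𝒱) j) (N : ℕ) :
        contract y g ∈ derivationFamilies 𝒱 (n + j) N :=
      mem_derivationFamilies_succ.1 (hg' (N + 1)) j y hy
    have hfg := hfx (unary_mem hg hx) N
    have hgf := hgx (unary_mem hf hx) N
    have hcf := ih (contract_mem hf hx) hg (hfx hx) hg'
    have hcg := ih hf (contract_mem hg hx) hf' (hgx hx)
    rw [show m + (i + n) = m + n + i by ring] at hfg
    rw [show n + (i + m) = m + n + i by ring] at hgf
    rw [show m + i + n = m + n + i by ring] at hcf
    rw [← add_assoc] at hcg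
    rw [contract_gradedCommutator _ m n f g hx]
    exact add_mem (add_mem (sub_mem hfg (zsmul_mem hgf _)) (zsmul_mem hcf _)) hcg

end DerivationFamilies

section Psi

variable {K V : Type*} [Field K] [AddCommGroup V] [Module K V]
  (𝒱 : ℤ → Submodule K V)

theorem mem_CV_iff {n : ℤ} {f : NambuFamily K V} :
    f ∈ CV 𝒱 n ↔ ∀ (a : ℕ) (d : Fin a → ℤ) (X : Fin a → V ⊗[K] V),
      (∀ i, X i ∈ tensorGrading 𝒱 (d i)) → f a X ∈ homDeg 𝒱 ((∑ i, d i) + n + a) := by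
  have hdeg (a : ℕ) (d : Fin a → ℤ) (e : ℤ) :
      (∑ i, d i) + e + (n + a) = e + ((∑ i, d i) + n + a) := by ring
  constructor
  · exact fun hf a d X hX e x hx => hdeg a d e ▸ hf a d e X x hX hx
  · exact fun hf a d e X x hX hx => (hdeg a d e).symm ▸ hf a d X hX e x hx

variable [DirectSum.Decomposition 𝒱]

theorem leibnizExt_curryRight (n : ℤ) {a : ℕ}
    (F : MultilinearMap K (fun _ : Fin a => V ⊗[K] V) (V →ₗ[K] V)) {d : Fin a → ℤ}
    {X : Fin a → V ⊗[K] V} (hX : ∀ i, X i ∈ tensorGrading 𝒱 (d i)) :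
    (leibnizExt 𝒱 n a F).curryRight X = derExt 𝒱 ((∑ i, d i) + n + a : ℤ) (F X) := by
  refine tensor_ext_homogeneous 𝒱 fun i x hx y => ?_
  rw [MultilinearMap.curryRight_apply, leibnizExt_apply 𝒱 n a F d i X x y hX hx,
    derExt_tmul 𝒱 _ _ hx, Int.cast_mul]

theorem psi_curryRight {n : ℤ} (f : CV 𝒱 n) {a : ℕ} {d : Fin a → ℤ} {X : Fin a → V ⊗[K] V}
    (hX : ∀ i, X i ∈ tensorGrading 𝒱 (d i)) :
    ((Psi 𝒱 n f : Family K (V ⊗[K] V)) a).curryRight X =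
      (-1 : ℤ) ^ ((a + 1) * a / 2) • derExt 𝒱 ((∑ i, d i) + n + a : ℤ) (f.1 a X) := by
  rw [← leibnizExt_curryRight 𝒱 n (f.1 a) hX]
  rfl

theorem psi_mem_derivationFamilies {n : ℤ} (f : CV 𝒱 n) (N : ℕ) :
    (Psi 𝒱 n f : Family K (V ⊗[K] V)) ∈ derivationFamilies 𝒱 n N := fun d X hX => by
  rw [psi_curryRight 𝒱 f hX]
  exact zsmul_mem (Submodule.mem_map_of_mem ((mem_CV_iff 𝒱).1 f.2 N d X hX)) _

theorem psi_injective (h2 : (2 : K) ≠ 0) (n : ℤ) : Function.Injective (Psi 𝒱 n) := by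
  refine (injective_iff_map_eq_zero _).2 fun f hf => Subtype.ext <| funext fun a => ?_
  refine multilinearMap_ext_homogeneous (tensorGrading 𝒱) fun d X hX => ?_
  have hder : derExt 𝒱 ((∑ i, d i) + n + a : ℤ) (f.1 a X) = 0 := by
    have hsign := psi_curryRight 𝒱 f hX
    rw [hf] at hsign
    rcases neg_one_pow_eq_or ℤ ((a + 1) * a / 2) with hs | hs
    · rw [hs, one_smul] at hsign
      exact hsign.symm
    · rw [hs, neg_one_smul] at hsign
      exact neg_eq_zero.1 hsign.symm
  exact eq_zero_of_derExt_eq_zero h2 (homDeg_le_homParity 𝒱 _ ((mem_CV_iff 𝒱).1 f.2 a d X hX)) hder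

/-- The inverse of `leibnizExt` on the maps that are derivations in their last argument; the sum
over `d` splits the other arguments into their parity components. -/
def leibnizRestrict (n : ℤ) (a : ℕ)
    (F : MultilinearMap K (fun _ : Fin (a + 1) => V ⊗[K] V) (V ⊗[K] V)) :
    MultilinearMap K (fun _ : Fin a => V ⊗[K] V) (V →ₗ[K] V) :=
  ∑ d : Fin a → ZMod 2, (derInv 𝒱 ((∑ i, d i) + n + a)).compMultilinearMap
    (F.curryRight.compLinearMap fun i => parityProj (tensorGrading 𝒱) (d i))

theorem leibnizRestrict_apply (n : ℤ) {a : ℕ}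
    (F : MultilinearMap K (fun _ : Fin (a + 1) => V ⊗[K] V) (V ⊗[K] V)) {d : Fin a → ℤ}
    {X : Fin a → V ⊗[K] V} (hX : ∀ i, X i ∈ tensorGrading 𝒱 (d i)) :
    leibnizRestrict 𝒱 n a F X = derInv 𝒱 ((∑ i, d i) + n + a : ℤ) (F.curryRight X) := by
  rw [leibnizRestrict, sum_apply]
  push_cast
  exact sum_parityProj (tensorGrading 𝒱) (fun d : Fin a → ZMod 2 =>
    (derInv 𝒱 ((∑ i, d i) + n + a)).compMultilinearMap F.curryRight) d X hX

theorem exists_psi_eq (h2 : (2 : K) ≠ 0) {n : ℤ} (F : CL (shift (tensorGrading 𝒱)) n)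
    (hF : ∀ N, F.1 ∈ derivationFamilies 𝒱 n N) : ∃ f, Psi 𝒱 n f = F := by
  let f : NambuFamily K V := fun a =>
    (-1 : ℤ) ^ ((a + 1) * a / 2) • leibnizRestrict 𝒱 n a (F.1 a)
  have hf (a : ℕ) (d : Fin a → ℤ) (X : Fin a → V ⊗[K] V)
      (hX : ∀ i, X i ∈ tensorGrading 𝒱 (d i)) : f a X = (-1 : ℤ) ^ ((a + 1) * a / 2) •
        derInv 𝒱 ((∑ i, d i) + n + a : ℤ) ((F.1 a).curryRight X) := by
    rw [← leibnizRestrict_apply 𝒱 n (F.1 a) hX]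
    rfl
  have hfCV : f ∈ CV 𝒱 n := (mem_CV_iff 𝒱).2 fun a d X hX =>
    hf a d X hX ▸ zsmul_mem (derInv_mem_homDeg h2 (hF a d X hX)) _
  refine ⟨⟨f, hfCV⟩, Subtype.ext <| funext fun a =>
    (multilinearCurryRightEquiv K (fun _ => V ⊗[K] V) (V ⊗[K] V)).injective <|
      multilinearMap_ext_homogeneous (tensorGrading 𝒱) fun d X hX => ?_⟩
  refine (psi_curryRight 𝒱 ⟨f, hfCV⟩ hX).trans ?_
  rw [hf a d X hX, map_zsmul, derExt_derInv h2 (hF a d X hX), smul_smul, ← mul_pow, neg_one_mul,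
    neg_neg, one_pow, one_smul]
  rfl

theorem psi_nambuBracket (h2 : (2 : K) ≠ 0) (m n : ℤ) (f : CV 𝒱 m) (g : CV 𝒱 n) :
    Psi 𝒱 (m + n) (nambuBracket 𝒱 m n f g) =
      balavoineBracket (shift (tensorGrading 𝒱)) m n (Psi 𝒱 m f) (Psi 𝒱 n g) :=
  Function.invFun_eq <| exists_psi_eq 𝒱 h2 _ <| gradedCommutator_mem_derivationFamilies
    (Psi 𝒱 m f).2 (Psi 𝒱 n g).2 (psi_mem_derivationFamilies 𝒱 f) (psi_mem_derivationFamilies 𝒱 g)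

theorem nambu_isGradedLieAlgebra (h2 : (2 : K) ≠ 0) :
    IsGradedLieAlgebra (CV 𝒱) (nambuBracket 𝒱) :=
  (balavoine_isGradedLieAlgebra (shift (tensorGrading 𝒱))).of_injective (Psi 𝒱)
    (psi_injective 𝒱 h2) (psi_nambuBracket 𝒱 h2)

theorem psi_isGradedLieHom (h2 : (2 : K) ≠ 0) :
    IsGradedLieHom (CV 𝒱) (CL (shift (tensorGrading 𝒱))) (nambuBracket 𝒱)
      (balavoineBracket (shift (tensorGrading 𝒱))) (Psi 𝒱) :=
  ⟨nambu_isGradedLieAlgebra 𝒱 h2, balavoine_isGradedLieAlgebra _, psi_nambuBracket 𝒱 h2⟩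

theorem psi_apply_snoc_tmul {n : ℤ} (f : CV 𝒱 n) {a : ℕ} {d : Fin a → ℤ} {e : ℤ}
    {X : Fin a → V ⊗[K] V} {x : V} (hX : ∀ i, X i ∈ tensorGrading 𝒱 (d i)) (hx : x ∈ 𝒱 e)
    (y : V) :
    (Psi 𝒱 n f : Family K (V ⊗[K] V)) a (Fin.snoc X (x ⊗ₜ[K] y)) =
      (-1 : ℤ) ^ ((a + 1) * a / 2) •
        (f.1 a X x ⊗ₜ[K] y +
          psgn ((e * ((∑ i, d i) + (a + n)) : ℤ) : ZMod 2) • (x ⊗ₜ[K] f.1 a X y)) := by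
  rw [← MultilinearMap.curryRight_apply, psi_curryRight 𝒱 f hX, LinearMap.smul_apply,
    derExt_tmul 𝒱 _ _ hx, ← Int.cast_mul, add_comm (a : ℤ) n, ← add_assoc]

end Psi

end HomotopyNambu

end

theorem mainTheorem4 {K V : Type*} [Field K] [AddCommGroup V] [Module K V] (h2 : (2 : K) ≠ 0)
    (𝒱 : ℤ → Submodule K V) [DirectSum.Decomposition 𝒱] :
    (∀ n : ℤ, Function.Injective (HomotopyNambu.Psi 𝒱 n)) ∧
    HomotopyNambu.IsGradedLieHom
      (HomotopyNambu.CV 𝒱)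
      (HomotopyNambu.CL (HomotopyNambu.shift (HomotopyNambu.tensorGrading 𝒱)))
      (HomotopyNambu.nambuBracket 𝒱)
      (HomotopyNambu.balavoineBracket (HomotopyNambu.shift (HomotopyNambu.tensorGrading 𝒱)))
      (HomotopyNambu.Psi 𝒱) ∧
    ∀ π : HomotopyNambu.CV 𝒱 1, HomotopyNambu.IsHomotopyNambu 𝒱 π →
      ∃ ℓ : HomotopyNambu.CL (HomotopyNambu.shift (HomotopyNambu.tensorGrading 𝒱)) 1,
        ℓ = HomotopyNambu.Psi 𝒱 1 π ∧
        HomotopyNambu.IsLeibnizInfinity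
          (HomotopyNambu.shift (HomotopyNambu.tensorGrading 𝒱)) ℓ ∧
        ∀ (a : ℕ) (d : Fin a → ℤ) (e : ℤ) (X : Fin a → V ⊗[K] V) (x y : V),
          (∀ i, X i ∈ HomotopyNambu.tensorGrading 𝒱 (d i)) → x ∈ 𝒱 e →
          ℓ.1 a (Fin.snoc X (x ⊗ₜ[K] y)) =
            (-1 : ℤ) ^ ((a + 1) * a / 2) •
              (π.1 a X x ⊗ₜ[K] y +
                HomotopyNambu.psgn ((e * ((∑ i, d i) + (a + 1)) : ℤ) : ZMod 2) •
                  (x ⊗ₜ[K] π.1 a X y)) :=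
  ⟨HomotopyNambu.psi_injective 𝒱 h2, HomotopyNambu.psi_isGradedLieHom 𝒱 h2, fun π hπ =>
    ⟨HomotopyNambu.Psi 𝒱 1 π, rfl, (HomotopyNambu.psi_isGradedLieHom 𝒱 h2).map_isMaurerCartan hπ,
      fun _ _ _ _ _ y hX hx => HomotopyNambu.psi_apply_snoc_tmul 𝒱 π hX hx y⟩⟩
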